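/- Let $\kappa\in\{2,3,4,\ldots\}\cup\{\infty\}$. For $R=(r_1,\ldots,r_m)\in\mathbb Z_{\ge 0}^m$ and $C=(c_1,\ldots,c_n)\in\mathbb Z_{\ge 0}^n$ with $\sum_i r_i=\sum_j c_j=N$, let $T_\kappa(R,C)$ be the number of $m\times n$ nonnegative integer matrices with row sums $R$, column sums $C$ and all entries at most $\kappa$ (no bound on the entries if $\kappa=\infty$). Let $\binom{n}{r}_\kappa$ denote the coefficient of $x^r$ in $(1+x+x^2+\cdots+x^\kappa)^n$ (in $(1+x+x^2+\cdots)^n$ if $\kappa=\infty$), and let $$I_\kappa(R,C):=\binom{mn}{N}_\kappa^{-1}\prod_{i=1}^m\binom{n}{r_i}_\kappa\prod_{j=1}^n\binom{m}{c_j}_\kappa$$ be the estimate of $T_\kappa(R,C)$ given by the heuristic that the row and the column conditions are independent. For $s\ge 1$ let $R^{(s)}\in\mathbb Z_{\ge 0}^{sm}$ be the concatenation of $s$ copies of $(sr_1,\ldots,sr_m)$, and define $C^{(s)}\in\mathbb Z_{\ge 0}^{sn}$ likewise. Then there is a constant $\delta=\delta(\kappa)\in(0,1)$, depending only on $\kappa$,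 with the following property. For all $m$, $n$, $N$, $R$, $C$ as above with $T_\kappa(R,C)>0$ and $$\Big(\max_{1\le i\le m} r_i\Big)\Big(\max_{1\le j\le n} c_j\Big)<\delta\kappa N$$ (for $\kappa=\infty$ this inequality means only that $N>0$), both of the following limits exist and are finite, and $$\lim_{s\to\infty}\frac1{s^2}\ln T_\kappa(R^{(s)},C^{(s)})\;\ge\;\lim_{s\to\infty}\frac1{s^2}\ln I_\kappa(R^{(s)},C^{(s)}).$$ The inequality is strict if neither $R$ nor $C$ is a constant vector (i.e., if neither $r_1=\cdots=r_m$ nor $c_1=\cdots=c_n$ holds). -/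

import Mathlib

open Filter Topology
open scoped ENNReal

noncomputable section

/-- The contingency tables with margins `R` and `C` and with all entries at most `κ`
(no bound on the entries if `κ = ⊤`). -/
def boundedTables (κ : ℕ∞) {m n : ℕ} (R : Fin m → ℕ) (C : Fin n → ℕ) :
    Set (Matrix (Fin m) (Fin n) ℕ) :=
  {A | (∀ i j, (A i j : ℕ∞) ≤ κ) ∧ (∀ i, ∑ j, A i j = R i) ∧ (∀ j, ∑ i, A i j = C j)}

/-- The row sums bound the entries, so there are finitely many tables (also for `κ = ⊤`). -/
theorem boundedTables_finite (κ : ℕ∞) {m n : ℕ} (R : Fin m → ℕ) (C : Fin n → ℕ) :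
    (boundedTables κ R C).Finite := by
  refine (Set.Finite.pi' (t := fun i : Fin m => {v : Fin n → ℕ | ∀ j, v j ∈ Set.Iic (R i)})
    fun i => Set.Finite.pi' fun _ => Set.finite_Iic (R i)).subset ?_
  intro A hA i j
  rw [Set.mem_Iic, ← hA.2.1 i]
  exact Finset.single_le_sum (f := fun j => A i j) (fun _ _ => Nat.zero_le _) (Finset.mem_univ j)

/-- `T_κ(R, C)`: the number of tables with margins `R` and `C` and entries at most `κ`. -/
def tableCount (κ : ℕ∞) {m n : ℕ} (R : Fin m → ℕ) (C : Fin n → ℕ) : ℕ :=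
  (boundedTables κ R C).ncard

/-- The `(κ+1)`-nomial coefficient: the coefficient of `x ^ r` in
`(1 + x + x ^ 2 + ⋯ + x ^ κ) ^ n`, where the inner sum is the full geometric series
if `κ = ⊤`. -/
def knomial (κ : ℕ∞) (n r : ℕ) : ℕ :=
  open scoped Classical in
  PowerSeries.coeff r ((PowerSeries.mk fun t : ℕ => if (t : ℕ∞) ≤ κ then (1 : ℕ) else 0) ^ n)

/-- The independence heuristic `I_κ(R, C)` for the number of tables; `∑ i, R i` is the
common sum of the two margins. -/
def indepEstimate (κ : ℕ∞) {m n : ℕ} (R : Fin m → ℕ) (C : Fin n → ℕ) : ℝ :=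
  (knomial κ (m * n) (∑ i, R i) : ℝ)⁻¹ * (∏ i, (knomial κ n (R i) : ℝ)) *
    ∏ j, (knomial κ m (C j) : ℝ)

/-- The `s`-fold cloning of a vector: `s` consecutive copies of `s • V`. -/
def clone (s : ℕ) {m : ℕ} (V : Fin m → ℕ) : Fin (s * m) → ℕ :=
  fun k => s * V k.modNat

end

/-!
Larger tables can be tiled by smaller ones, so `log T` of the cloned margins is superadditive in a
two-dimensional sense and its normalised limit exists and bounds all its terms from above. If the
`(i, j)` tile is chosen with sum proportional to `R i * C j / N`, and the vectors of its entries are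
regrouped by margins and symmetrised by rotations, the limit is seen to be at least
`∑ i, ∑ j, H (R i * C j / N)`, where `H x` is the exponential growth rate per entry of the number
of vectors of mean `x`. The estimate `I` grows at the corresponding combination of values of `H` at
the means of the rows, the columns and the whole table, and the difference of the two rates is the
Jensen gap, over the columns, of the function `y ↦ ∑ i, H (u i * y) - m * H y` whose weights `u`
are the row sums normalised to mean `1`. The second derivative of this function times `y ^ 2` is
positive by Jensen's inequality, now over the rows, as soon as `x ^ 2 * H'' x` is strictly convex.

By Cramér's theorem `H x = log (F z) - x * log z` at the saddle point `z = Z x` of the generating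
function `F z = 1 + z + ⋯ + z ^ κ`, so that `H'' = -Z' / Z`. For `κ = ⊤` one has
`Z x = x / (1 + x)`; for finite `κ` the saddle point is an analytic function of `x` near `0`, where
strict convexity can be read off from the first three coefficients `1, 1, 1` of `F`, and `δ`
measures the size of the neighbourhood of `0` thus obtained.
-/

theorem tendsto_log_div_natCast_of_le_mul_pow {u : ℕ → ℝ} {c : ℝ} {d : ℕ} (h1 : ∀ p, 1 ≤ u p)
    (hu : ∀ p ≠ 0, u p ≤ c * (p : ℝ) ^ d) :
    Tendsto (fun p : ℕ => Real.log (u p) / p) atTop (𝓝 0) := by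
  have hlog : Tendsto (fun p : ℕ => Real.log p / p) atTop (𝓝 0) :=
    (Real.isLittleO_log_id_atTop.tendsto_div_nhds_zero).comp tendsto_natCast_atTop_atTop
  have hbound : Tendsto (fun p : ℕ => Real.log c / p + d * (Real.log p / p)) atTop (𝓝 0) := by
    simpa using (tendsto_const_div_atTop_nhds_zero_nat (Real.log c)).add (hlog.const_mul (d : ℝ))
  refine squeeze_zero' (Eventually.of_forall fun p =>
    div_nonneg (Real.log_nonneg (h1 p)) p.cast_nonneg) ?_ hbound
  filter_upwards [eventually_ne_atTop 0] with p hp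
  have hp' : (0 : ℝ) < (p : ℝ) ^ d := by positivity
  have hc : 0 < c := pos_of_mul_pos_left (one_pos.trans_le ((h1 p).trans (hu p hp))) hp'.le
  rw [← mul_div_assoc, ← add_div]
  gcongr
  rw [← Real.log_pow, ← Real.log_mul hc.ne' hp'.ne']
  exact Real.log_le_log (one_pos.trans_le (h1 p)) (hu p hp)

theorem tendsto_natCast_div_div_natCast (k : ℕ) :
    Tendsto (fun s : ℕ => ((s / k : ℕ) : ℝ) / s) atTop (𝓝 (k : ℝ)⁻¹) := by
  refine ((tendsto_nat_floor_mul_div_atTop (inv_nonneg.2 k.cast_nonneg)).comp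
    tendsto_natCast_atTop_atTop).congr fun s => ?_
  rw [Function.comp, inv_mul_eq_div, Nat.floor_div_eq_div]

/-- Fekete's lemma in dimension `d`, for sequences which are superadditive along the tilings of
a cube of side `q * k + t` by `q ^ d` cubes of side `k`. -/
theorem exists_tendsto_div_pow {u : ℕ → ℝ} {B : ℝ} {d : ℕ}
    (hB : ∀ s, u s ≤ B * (s : ℝ) ^ d) (hu : ∀ k q t : ℕ, (q : ℝ) ^ d * u k ≤ u (q * k + t)) :
    ∃ L, Tendsto (fun s : ℕ => u s / (s : ℝ) ^ d) atTop (𝓝 L) ∧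
      ∀ k : ℕ, u k / (k : ℝ) ^ d ≤ L := by
  have hbdd : BddAbove (Set.range fun s : ℕ => u s / (s : ℝ) ^ d) := by
    refine ⟨max B 0, Set.forall_mem_range.2 fun s => div_le_of_le_mul₀ (by positivity)
      (le_max_right _ _) ((hB s).trans ?_)⟩
    gcongr
    exact le_max_left _ _
  refine ⟨⨆ s : ℕ, u s / (s : ℝ) ^ d, ?_, le_ciSup hbdd⟩
  refine tendsto_order.2 ⟨fun a ha => ?_, fun a ha => Eventually.of_forall fun s =>
    (le_ciSup hbdd s).trans_lt ha⟩
  obtain ⟨k, hk⟩ := exists_lt_of_lt_ciSup ha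
  have hlim : Tendsto (fun s : ℕ => (((s / k : ℕ) : ℝ) / s) ^ d * u k) atTop
      (𝓝 (u k / (k : ℝ) ^ d)) := by
    rw [div_eq_inv_mul, ← inv_pow]
    exact ((tendsto_natCast_div_div_natCast k).pow d).mul_const _
  filter_upwards [hlim.eventually_const_lt hk] with s hs
  refine hs.trans_le ?_
  have htile := hu k (s / k) (s % k)
  rw [Nat.div_add_mod'] at htile
  rw [div_pow, div_mul_eq_mul_div]
  gcongr

theorem eventually_nhdsGT_lt_of_hasDerivAt_neg {f : ℝ → ℝ} {d x : ℝ} (hf : HasDerivAt f d x)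
    (hd : d < 0) : ∀ᶠ y in 𝓝[>] x, f y < f x := by
  have h := (hasDerivAt_iff_tendsto_slope.1 hf).mono_left
    (nhdsWithin_mono x fun y (hy : x < y) => hy.ne')
  filter_upwards [h.eventually_lt_const hd, self_mem_nhdsWithin] with y hy hxy
  rw [slope_def_field, div_lt_iff₀ (sub_pos.2 hxy)] at hy
  linarith

theorem eventually_nhdsLT_lt_of_hasDerivAt_pos {f : ℝ → ℝ} {d x : ℝ} (hf : HasDerivAt f d x)
    (hd : 0 < d) : ∀ᶠ y in 𝓝[<] x, f y < f x := by
  have h := (hasDerivAt_iff_tendsto_slope.1 hf).mono_left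
    (nhdsWithin_mono x fun y (hy : y < x) => hy.ne)
  filter_upwards [h.eventually_const_lt hd, self_mem_nhdsWithin] with y hy hxy
  rw [slope_def_field, lt_div_iff_of_neg (sub_neg.2 hxy)] at hy
  linarith

theorem exists_strictConvexOn_sq_mul {f : ℝ → ℝ} (hf : AnalyticAt ℝ f 0) (h0 : 0 < f 0) :
    ∃ ε > 0, ∀ b ≤ ε, StrictConvexOn ℝ (Set.Ico 0 b) fun x => x ^ 2 * f x := by
  have hφ : AnalyticAt ℝ (fun x => x ^ 2 * f x) 0 := (analyticAt_id.pow 2).mul hf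
  have hderiv : deriv (fun x => x ^ 2 * f x) =ᶠ[𝓝 0] fun x => x * (2 * f x + x * deriv f x) := by
    filter_upwards [hf.eventually_analyticAt] with x hx
    rw [((hasDerivAt_pow 2 x).fun_mul hx.differentiableAt.hasDerivAt).deriv]
    push_cast
    ring
  have hderiv2 : deriv (deriv fun x => x ^ 2 * f x) 0 = 2 * f 0 := by
    have hg : DifferentiableAt ℝ (fun x => 2 * f x + x * deriv f x) 0 :=
      (hf.differentiableAt.const_mul 2).add (differentiableAt_id.mul hf.deriv.differentiableAt)
    rw [hderiv.deriv_eq, ((hasDerivAt_id' (0 : ℝ)).fun_mul hg.hasDerivAt).deriv]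
    simp
  have hpos : ∀ᶠ x in 𝓝 (0 : ℝ), 0 < deriv (deriv fun x => x ^ 2 * f x) x :=
    hφ.deriv.deriv.continuousAt.eventually (lt_mem_nhds (by rw [hderiv2]; linarith))
  obtain ⟨ε, hε, hball⟩ := Metric.eventually_nhds_iff.1 (hφ.eventually_continuousAt.and hpos)
  have hmem : ∀ b ≤ ε, ∀ x ∈ Set.Ico 0 b, dist x 0 < ε := fun b hb x hx => by
    rw [Real.dist_eq, sub_zero, abs_of_nonneg hx.1]
    exact hx.2.trans_le hb
  exact ⟨ε, hε, fun b hb => strictConvexOn_of_deriv2_pos' (convex_Ico 0 b)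
    (fun x hx => (hball (hmem b hb x hx)).1.continuousWithinAt)
    fun x hx => (hball (hmem b hb x hx)).2⟩

theorem knomial_zero (κ : ℕ∞) (r : ℕ) : knomial κ 0 r = if r = 0 then 1 else 0 := by
  rw [knomial, pow_zero, PowerSeries.coeff_one]

open scoped Classical in
theorem knomial_one (κ : ℕ∞) (r : ℕ) : knomial κ 1 r = if (r : ℕ∞) ≤ κ then 1 else 0 := by
  rw [knomial, pow_one, PowerSeries.coeff_mk]

theorem knomial_one_le_one (κ : ℕ∞) (r : ℕ) : knomial κ 1 r ≤ 1 := by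
  rw [knomial_one]
  split_ifs <;> simp

theorem knomial_one_of_le {κ : ℕ∞} {r : ℕ} (h : (r : ℕ∞) ≤ κ) : knomial κ 1 r = 1 := by
  rw [knomial_one, if_pos h]

theorem knomial_add (κ : ℕ∞) (a b r : ℕ) :
    knomial κ (a + b) r =
      ∑ p ∈ Finset.HasAntidiagonal.antidiagonal r, knomial κ a p.1 * knomial κ b p.2 := by
  simp only [knomial, pow_add, PowerSeries.coeff_mul]

theorem knomial_mul_le (κ : ℕ∞) (a b r r' : ℕ) :
    knomial κ a r * knomial κ b r' ≤ knomial κ (a + b) (r + r') := by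
  rw [knomial_add]
  exact Finset.single_le_sum (f := fun p : ℕ × ℕ => knomial κ a p.1 * knomial κ b p.2)
    (fun _ _ => Nat.zero_le _) (a := (r, r')) (by simp)

theorem knomial_pow_le (κ : ℕ∞) (n r q : ℕ) :
    knomial κ n r ^ q ≤ knomial κ (q * n) (q * r) := by
  induction q with
  | zero => simp [knomial_zero]
  | succ q ih =>
    rw [pow_succ, Nat.succ_mul, Nat.succ_mul]
    exact (Nat.mul_le_mul_right _ ih).trans (knomial_mul_le ..)

theorem knomial_pos {κ : ℕ∞} {K n r : ℕ} (hK : (K : ℕ∞) ≤ κ) (hr : r ≤ K * n) :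
    0 < knomial κ n r := by
  induction n generalizing r with
  | zero => simp_all [knomial_zero]
  | succ n ih =>
    have hlast : 0 < knomial κ 1 (min r K) := by
      rw [knomial_one_of_le ((Nat.cast_le.2 (min_le_right r K)).trans hK)]
      exact one_pos
    have hinit : 0 < knomial κ n (r - min r K) := ih (by rw [mul_add, mul_one] at hr; omega)
    have h := knomial_mul_le κ n 1 (r - min r K) (min r K)
    rw [Nat.sub_add_cancel (min_le_left _ _)] at h
    exact (Nat.mul_pos hinit hlast).trans_le h

/-- The generating function `1 + z + z ^ 2 + ⋯ + z ^ κ` of the multiplicities of one entry,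
meaningful as a real function for `|z| < 1` if `κ = ⊤`. -/
noncomputable def knomialGF (κ : ℕ∞) (z : ℝ) : ℝ :=
  ∑' t, (knomial κ 1 t : ℝ) * z ^ t

theorem knomialGF_top {z : ℝ} (hz : |z| < 1) : knomialGF ⊤ z = (1 - z)⁻¹ := by
  simp only [knomialGF, knomial_one_of_le le_top, Nat.cast_one, one_mul]
  exact tsum_geometric_of_abs_lt_one hz

theorem knomialGF_natCast (K : ℕ) (z : ℝ) :
    knomialGF K z = ∑ t ∈ Finset.range (K + 1), z ^ t := by
  rw [knomialGF, tsum_eq_sum (s := Finset.range (K + 1))]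
  · refine Finset.sum_congr rfl fun t ht => ?_
    rw [knomial_one_of_le (Nat.cast_le.2 (Finset.mem_range_succ_iff.1 ht)), Nat.cast_one, one_mul]
  · intro t ht
    rw [knomial_one, if_neg (by rwa [Nat.cast_le, ← Finset.mem_range_succ_iff]), Nat.cast_zero,
      zero_mul]

section GeneratingFunction

variable (κ : ℕ∞) {z : ℝ}

theorem hasSum_knomialGF (h0 : 0 ≤ z) (h1 : z < 1) :
    HasSum (fun t => (knomial κ 1 t : ℝ) * z ^ t) (knomialGF κ z) := by
  refine (Summable.of_nonneg_of_le (fun t => by positivity) (fun t => ?_)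
    (summable_geometric_of_lt_one h0 h1)).hasSum
  exact mul_le_of_le_one_left (pow_nonneg h0 t) (mod_cast knomial_one_le_one κ t)

theorem hasSum_knomial (h0 : 0 ≤ z) (h1 : z < 1) (n : ℕ) :
    HasSum (fun r => (knomial κ n r : ℝ) * z ^ r) (knomialGF κ z ^ n) := by
  induction n with
  | zero =>
    rw [pow_zero]
    convert hasSum_ite_eq (0 : ℕ) (1 : ℝ) using 2 with r
    by_cases h : r = 0 <;> simp [knomial_zero, h]
  | succ n ih =>
    have hone := hasSum_knomialGF κ h0 h1
    have hconv : ∀ r, (knomial κ (n + 1) r : ℝ) * z ^ r =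
        ∑ p ∈ Finset.HasAntidiagonal.antidiagonal r,
          (knomial κ n p.1 : ℝ) * z ^ p.1 * ((knomial κ 1 p.2 : ℝ) * z ^ p.2) := fun r => by
      rw [knomial_add, Nat.cast_sum, Finset.sum_mul]
      refine Finset.sum_congr rfl fun p hp => ?_
      rw [← Finset.HasAntidiagonal.mem_antidiagonal.1 hp, pow_add]
      push_cast
      ring
    have hsum := summable_norm_sum_mul_antidiagonal_of_summable_norm
      ih.summable.norm hone.summable.norm
    have htsum := tsum_mul_tsum_eq_tsum_sum_antidiagonal_of_summable_norm
      ih.summable.norm hone.summable.norm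
    rw [ih.tsum_eq, hone.tsum_eq] at htsum
    simp only [hconv]
    rw [pow_succ, htsum]
    exact hsum.of_norm.hasSum

theorem knomial_mul_pow_le (h0 : 0 ≤ z) (h1 : z < 1) (n r : ℕ) :
    (knomial κ n r : ℝ) * z ^ r ≤ knomialGF κ z ^ n :=
  le_hasSum (hasSum_knomial κ h0 h1 n) r fun _ _ => by positivity

theorem one_le_knomialGF (h0 : 0 ≤ z) (h1 : z < 1) : 1 ≤ knomialGF κ z := by
  simpa [knomial_one_of_le] using knomial_mul_pow_le κ h0 h1 1 0

theorem knomialGF_le (h0 : 0 ≤ z) (h1 : z < 1) : knomialGF κ z ≤ (1 - z)⁻¹ := by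
  refine hasSum_le (fun t => ?_) (hasSum_knomialGF κ h0 h1) (hasSum_geometric_of_lt_one h0 h1)
  exact mul_le_of_le_one_left (pow_nonneg h0 t) (mod_cast knomial_one_le_one κ t)

end GeneratingFunction

theorem knomial_le_two_pow (κ : ℕ∞) (n r : ℕ) : knomial κ n r ≤ 2 ^ (n + r) := by
  have hz : (0 : ℝ) ≤ 1 / 2 ∧ (1 / 2 : ℝ) < 1 := by norm_num
  have h : (knomial κ n r : ℝ) * (1 / 2) ^ r ≤ 2 ^ n :=
    (knomial_mul_pow_le κ hz.1 hz.2 n r).trans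
      (pow_le_pow_left₀ (zero_le_one.trans (one_le_knomialGF κ hz.1 hz.2))
        ((knomialGF_le κ hz.1 hz.2).trans (by norm_num)) n)
  rw [one_div, inv_pow, ← div_eq_mul_inv, div_le_iff₀ (by positivity), ← pow_add] at h
  exact_mod_cast h

section Tables

variable {I J I' J' A B : Type*} [Fintype I] [Fintype J] [Fintype I'] [Fintype J'] [Fintype A]
  [Fintype B]

/-- The vectors indexed by `I` with entries at most `κ` and with sum `r`, the rows of a table. -/
def boundedVectors (κ : ℕ∞) (I : Type*) [Fintype I] [DecidableEq I] (r : ℕ) : Finset (I → ℕ) :=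
  {v ∈ Finset.piAntidiag Finset.univ r | ∀ i, (v i : ℕ∞) ≤ κ}

theorem mem_boundedVectors [DecidableEq I] {κ : ℕ∞} {r : ℕ} {v : I → ℕ} :
    v ∈ boundedVectors κ I r ↔ ∑ i, v i = r ∧ ∀ i, (v i : ℕ∞) ≤ κ := by
  simp [boundedVectors]

theorem card_boundedVectors [DecidableEq I] (κ : ℕ∞) (r : ℕ) :
    (boundedVectors κ I r).card = knomial κ (Fintype.card I) r := by
  rw [knomial, ← Finset.card_univ, ← Finset.prod_const, PowerSeries.coeff_prod]
  simp only [PowerSeries.coeff_mk, Finset.prod_ite_zero, Finset.prod_const_one, Finset.sum_boole,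
    Finset.mem_univ, true_implies, Nat.cast_id]
  refine Finset.card_bij' (fun v _ => Finsupp.equivFunOnFinite.symm v) (fun l _ => ⇑l) ?_ ?_
    (fun _ _ => rfl) fun _ _ => Finsupp.ext fun _ => rfl
  all_goals simp +contextual [mem_boundedVectors]

theorem card_piAntidiag_univ_le [DecidableEq I] (r : ℕ) :
    (Finset.piAntidiag (Finset.univ : Finset I) r).card ≤ (r + 1) ^ Fintype.card I := by
  have hbox : (Fintype.piFinset fun _ : I => Finset.range (r + 1)).card =
      (r + 1) ^ Fintype.card I := by simp
  refine hbox ▸ Finset.card_le_card fun v hv => Fintype.mem_piFinset.2 fun i => ?_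
  rw [Finset.mem_range_succ_iff, ← (Finset.mem_piAntidiag.1 hv).1]
  exact Finset.single_le_sum (f := v) (fun _ _ => Nat.zero_le _) (Finset.mem_univ i)

/-- The contingency tables with margins `R` and `C` and entries at most `κ`, with rows and columns
indexed by arbitrary finite types, so that tables can be assembled from blocks. -/
def marginTables (κ : ℕ∞) (R : I → ℕ) (C : J → ℕ) : Set (I → J → ℕ) :=
  {A | (∀ i j, (A i j : ℕ∞) ≤ κ) ∧ (∀ i, ∑ j, A i j = R i) ∧ ∀ j, ∑ i, A i j = C j}

theorem finite_marginTables (κ : ℕ∞) (R : I → ℕ) (C : J → ℕ) : (marginTables κ R C).Finite := by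
  refine (Set.Finite.pi' fun i => Set.Finite.pi' fun _ : J => Set.finite_Iic (R i)).subset ?_
  intro A hA i j
  rw [Set.mem_Iic, ← hA.2.1 i]
  exact Finset.single_le_sum (fun _ _ => Nat.zero_le _) (Finset.mem_univ j)

/-- The number of contingency tables with margins `R` and `C` and entries at most `κ`. -/
noncomputable def marginCount (κ : ℕ∞) (R : I → ℕ) (C : J → ℕ) : ℕ :=
  (marginTables κ R C).ncard

theorem tableCount_eq_marginCount (κ : ℕ∞) {m n : ℕ} (R : Fin m → ℕ) (C : Fin n → ℕ) :
    tableCount κ R C = marginCount κ R C := rfl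

theorem marginCount_pos_iff {κ : ℕ∞} {R : I → ℕ} {C : J → ℕ} :
    0 < marginCount κ R C ↔ (marginTables κ R C).Nonempty :=
  Set.ncard_pos (finite_marginTables κ R C)

theorem sum_eq_sum_of_marginCount_pos {κ : ℕ∞} {R : I → ℕ} {C : J → ℕ}
    (h : 0 < marginCount κ R C) : ∑ i, R i = ∑ j, C j := by
  obtain ⟨A, hA⟩ := marginCount_pos_iff.1 h
  simp only [← hA.2.1, ← hA.2.2]
  exact Finset.sum_comm

theorem marginCount_le_comp_equiv (κ : ℕ∞) (R : I → ℕ) (C : J → ℕ) (e : I' ≃ I) (f : J' ≃ J) :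
    marginCount κ R C ≤ marginCount κ (R ∘ e) (C ∘ f) := by
  refine Set.ncard_le_ncard_of_injOn (fun A i j => A (e i) (f j)) ?_ ?_ (finite_marginTables _ _ _)
  · intro A hA
    refine ⟨fun i j => hA.1 _ _, fun i => ?_, fun j => ?_⟩
    · rw [Function.comp, ← hA.2.1]
      exact f.sum_comp (A (e i))
    · rw [Function.comp, ← hA.2.2]
      exact e.sum_comp fun i => A i (f j)
  · intro A _ A' _ h
    funext i j
    simpa using congrFun (congrFun h (e.symm i)) (f.symm j)

theorem marginCount_comp_equiv (κ : ℕ∞) (R : I → ℕ) (C : J → ℕ) (e : I' ≃ I) (f : J' ≃ J) :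
    marginCount κ (R ∘ e) (C ∘ f) = marginCount κ R C := by
  refine le_antisymm ?_ (marginCount_le_comp_equiv κ R C e f)
  simpa [Function.comp_def] using marginCount_le_comp_equiv κ (R ∘ e) (C ∘ f) e.symm f.symm

theorem marginCount_le_swap (κ : ℕ∞) (R : I → ℕ) (C : J → ℕ) :
    marginCount κ R C ≤ marginCount κ C R := by
  refine Set.ncard_le_ncard_of_injOn (fun A j i => A i j) ?_ ?_ (finite_marginTables _ _ _)
  · exact fun A hA => ⟨fun i j => hA.1 _ _, hA.2.2, hA.2.1⟩
  · intro A _ A' _ h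
    funext i j
    exact congrFun (congrFun h j) i

theorem marginCount_swap (κ : ℕ∞) (R : I → ℕ) (C : J → ℕ) :
    marginCount κ R C = marginCount κ C R :=
  le_antisymm (marginCount_le_swap κ R C) (marginCount_le_swap κ C R)

theorem marginCount_mul_le_sumElim (κ : ℕ∞) (R : I → ℕ) (R' : I' → ℕ) (C C' : J → ℕ) :
    marginCount κ R C * marginCount κ R' C' ≤ marginCount κ (Sum.elim R R') (C + C') := by
  rw [marginCount, marginCount, ← Set.ncard_prod]
  refine Set.ncard_le_ncard_of_injOn (fun p => Sum.elim p.1 p.2) ?_ ?_ (finite_marginTables _ _ _)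
  · rintro ⟨A, A'⟩ ⟨hA, hA'⟩
    refine ⟨?_, ?_, fun j => ?_⟩
    · rintro (i | i) j
      exacts [hA.1 i j, hA'.1 i j]
    · rintro (i | i)
      exacts [hA.2.1 i, hA'.2.1 i]
    · simp only [Fintype.sum_sum_type, Sum.elim_inl, Sum.elim_inr, Pi.add_apply]
      rw [hA.2.2, hA'.2.2]
  · rintro ⟨A, A'⟩ _ ⟨D, D'⟩ _ h
    refine Prod.ext ?_ ?_
    · funext i; exact congrFun h (Sum.inl i)
    · funext i; exact congrFun h (Sum.inr i)

theorem prod_marginCount_le (κ : ℕ∞) (R : A → B → I → ℕ) (C : A → B → J → ℕ) :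
    ∏ a, ∏ b, marginCount κ (R a b) (C a b) ≤
      marginCount κ (fun p : A × I => ∑ b, R p.1 b p.2) (fun q : B × J => ∑ a, C a q.1 q.2) := by
  classical
  have hprod : ∏ a, ∏ b, marginCount κ (R a b) (C a b) =
      (Set.univ.pi fun p : A × B => marginTables κ (R p.1 p.2) (C p.1 p.2)).ncard := by
    rw [← Nat.card_coe_set_eq, Nat.card_congr (Equiv.Set.univPi _), Nat.card_pi,
      Fintype.prod_prod_type]
    rfl
  rw [hprod]
  refine Set.ncard_le_ncard_of_injOn
    (fun M (p : A × I) (q : B × J) => M (p.1, q.1) p.2 q.2) ?_ ?_ (finite_marginTables _ _ _)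
  · intro M hM
    have hM' : ∀ a b, M (a, b) ∈ marginTables κ (R a b) (C a b) := fun a b => hM (a, b) trivial
    refine ⟨fun p q => (hM' _ _).1 _ _, fun p => ?_, fun q => ?_⟩
    · rw [Fintype.sum_prod_type]
      exact Finset.sum_congr rfl fun b _ => (hM' p.1 b).2.1 p.2
    · rw [Fintype.sum_prod_type]
      exact Finset.sum_congr rfl fun a _ => (hM' a q.1).2.2 q.2
  · intro M _ M' _ h
    funext ⟨a, b⟩ i j
    exact congrFun (congrFun h (a, i)) (b, j)

theorem knomial_eq_sum_marginCount [DecidableEq I] [DecidableEq J] (κ : ℕ∞) (r : ℕ) :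
    knomial κ (Fintype.card I * Fintype.card J) r =
      ∑ p ∈ Finset.piAntidiag (Finset.univ : Finset I) r ×ˢ
        Finset.piAntidiag (Finset.univ : Finset J) r, marginCount κ p.1 p.2 := by
  let margins (v : I × J → ℕ) : (I → ℕ) × (J → ℕ) :=
    (fun i => ∑ j, v (i, j), fun j => ∑ i, v (i, j))
  have hmaps : ∀ v ∈ boundedVectors κ (I × J) r, margins v ∈
      Finset.piAntidiag (Finset.univ : Finset I) r ×ˢ
        Finset.piAntidiag (Finset.univ : Finset J) r := by
    intro v hv
    have hsum := (mem_boundedVectors.1 hv).1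
    simpa [margins, ← Fintype.sum_prod_type, ← Fintype.sum_prod_type_right] using hsum
  rw [← Fintype.card_prod, ← card_boundedVectors, Finset.card_eq_sum_card_fiberwise hmaps]
  refine Finset.sum_congr rfl fun p hp => ?_
  rw [← Set.ncard_coe_finset]
  refine Set.ncard_congr (fun v _ i j => v (i, j)) ?_ ?_ ?_
  · intro v hv
    obtain ⟨hmem, rfl⟩ := Finset.mem_filter.1 (Finset.mem_coe.1 hv)
    exact ⟨fun i j => (mem_boundedVectors.1 hmem).2 (i, j), fun _ => rfl, fun _ => rfl⟩
  · intro v v' _ _ h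
    funext ⟨i, j⟩
    exact congrFun (congrFun h i) j
  · intro A hA
    refine ⟨fun q => A q.1 q.2, Finset.mem_coe.2 <| Finset.mem_filter.2
      ⟨mem_boundedVectors.2 ⟨?_, fun q => hA.1 _ _⟩,
        Prod.ext (funext hA.2.1) (funext hA.2.2)⟩, rfl⟩
    rw [Fintype.sum_prod_type, ← (Finset.mem_piAntidiag.1 (Finset.mem_product.1 hp).1).1]
    exact Finset.sum_congr rfl fun i _ => hA.2.1 i

theorem marginCount_le_knomial (κ : ℕ∞) (R : I → ℕ) (C : J → ℕ) :
    marginCount κ R C ≤ knomial κ (Fintype.card I * Fintype.card J) (∑ i, R i) := by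
  classical
  rcases Nat.eq_zero_or_pos (marginCount κ R C) with h0 | hpos
  · exact h0 ▸ Nat.zero_le _
  · rw [knomial_eq_sum_marginCount]
    exact Finset.single_le_sum (f := fun p : (I → ℕ) × (J → ℕ) => marginCount κ p.1 p.2)
      (a := (R, C)) (fun _ _ => Nat.zero_le _) (by simp [sum_eq_sum_of_marginCount_pos hpos])

theorem exists_knomial_le_marginCount {κ : ℕ∞} {r : ℕ}
    (h : 0 < knomial κ (Fintype.card I * Fintype.card J) r) :
    ∃ (R : I → ℕ) (C : J → ℕ), ∑ i, R i = r ∧ ∑ j, C j = r ∧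
      knomial κ (Fintype.card I * Fintype.card J) r ≤
        (r + 1) ^ (Fintype.card I + Fintype.card J) * marginCount κ R C := by
  classical
  rw [knomial_eq_sum_marginCount] at h ⊢
  obtain ⟨⟨R, C⟩, hmem, hmax⟩ := Finset.exists_max_image _
    (fun p : (I → ℕ) × (J → ℕ) => marginCount κ p.1 p.2) (Finset.nonempty_of_sum_ne_zero h.ne')
  obtain ⟨hR, hC⟩ : ∑ i, R i = r ∧ ∑ j, C j = r := by simpa using hmem
  refine ⟨R, C, hR, hC, (Finset.sum_le_card_nsmul _ _ _ hmax).trans ?_⟩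
  rw [smul_eq_mul, Finset.card_product, pow_add]
  gcongr <;> exact card_piAntidiag_univ_le r

theorem marginCount_pow_le_const (κ : ℕ∞) {q : ℕ} [NeZero q] {R C : Fin q → ℕ} {r : ℕ}
    (hR : ∑ i, R i = r) (hC : ∑ j, C j = r) :
    marginCount κ R C ^ (q * q) ≤
      marginCount κ (fun _ : Fin q × Fin q => r) (fun _ : Fin q × Fin q => r) := by
  -- The `(a, b)` block has both margins rotated by `a + b`, which equalizes the total margins.
  have h := prod_marginCount_le κ (fun a b i : Fin q => R (i + a + b))
    (fun a b j : Fin q => C (j + b + a))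
  have hblock : ∀ a b : Fin q, marginCount κ (fun i : Fin q => R (i + a + b))
      (fun j : Fin q => C (j + b + a)) = marginCount κ R C := fun a b => by
    rw [← marginCount_comp_equiv κ R C (Equiv.addRight (a + b)) (Equiv.addRight (b + a))]
    simp only [Function.comp_def, Equiv.coe_addRight, add_assoc]
  have hsum : ∀ (V : Fin q → ℕ) (p : Fin q × Fin q), ∑ b, V (p.2 + p.1 + b) = ∑ i, V i :=
    fun V p => Equiv.sum_comp (Equiv.addLeft (p.2 + p.1)) V
  simp only [hblock, Finset.prod_const, Finset.card_univ, Fintype.card_fin, ← pow_mul] at h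
  simpa only [hsum, hR, hC] using h

theorem knomial_pow_le_marginCount_const (κ : ℕ∞) (q : ℕ) [NeZero q] (r : ℕ) :
    knomial κ (q * q) r ^ (q * q) ≤ (r + 1) ^ (2 * q * (q * q)) *
      marginCount κ (fun _ : Fin q × Fin q => r) (fun _ : Fin q × Fin q => r) := by
  have hq := NeZero.ne q
  rcases Nat.eq_zero_or_pos (knomial κ (q * q) r) with h0 | hpos
  · simp [h0, hq]
  · rw [← Fintype.card_fin q] at hpos
    obtain ⟨R, C, hR, hC, hle⟩ := exists_knomial_le_marginCount hpos
    rw [Fintype.card_fin, ← two_mul] at hle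
    calc _ ≤ ((r + 1) ^ (2 * q) * marginCount κ R C) ^ (q * q) := Nat.pow_le_pow_left hle _
      _ = (r + 1) ^ (2 * q * (q * q)) * marginCount κ R C ^ (q * q) := by rw [mul_pow, ← pow_mul]
      _ ≤ _ := Nat.mul_le_mul_left _ (marginCount_pow_le_const κ hR hC)

end Tables

section Tiling

variable {I J : Type*} [Fintype I] [Fintype J]

/-- The number of tables whose margins are those of an `a × b` array of tables with margins `R`
and `C`. -/
noncomputable def tiledCount (κ : ℕ∞) (R : I → ℕ) (C : J → ℕ) (a b : ℕ) : ℕ :=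
  marginCount κ (fun p : Fin a × I => b * R p.2) (fun p : Fin b × J => a * C p.2)

variable {κ : ℕ∞} {R : I → ℕ} {C : J → ℕ}

theorem tiledCount_swap (κ : ℕ∞) (R : I → ℕ) (C : J → ℕ) (a b : ℕ) :
    tiledCount κ R C a b = tiledCount κ C R b a :=
  marginCount_swap _ _ _

theorem tiledCount_pos (h : 0 < marginCount κ R C) (a b : ℕ) : 0 < tiledCount κ R C a b := by
  obtain ⟨A, hA⟩ := marginCount_pos_iff.1 h
  refine marginCount_pos_iff.2 ⟨fun p q => A p.2 q.2, fun p q => hA.1 _ _, fun p => ?_, fun q => ?_⟩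
  · simp only [Fintype.sum_prod_type, hA.2.1, Finset.sum_const, Finset.card_univ, Fintype.card_fin,
      smul_eq_mul]
  · simp only [Fintype.sum_prod_type, hA.2.2, Finset.sum_const, Finset.card_univ, Fintype.card_fin,
      smul_eq_mul]

theorem tiledCount_mul_le_add_left (κ : ℕ∞) (R : I → ℕ) (C : J → ℕ) (a a' b : ℕ) :
    tiledCount κ R C a b * tiledCount κ R C a' b ≤ tiledCount κ R C (a + a') b := by
  refine (marginCount_mul_le_sumElim _ _ _ _ _).trans_eq ?_
  rw [tiledCount, ← marginCount_comp_equiv κ _ _ ((Equiv.sumProdDistrib _ _ _).symm.trans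
    (finSumFinEquiv.prodCongr (Equiv.refl I))) (Equiv.refl _)]
  congr 1
  · funext p
    rcases p with p | p <;> rfl
  · funext p
    exact (add_mul a a' _).symm

theorem tiledCount_le_add_left (h : 0 < marginCount κ R C) (a a' b : ℕ) :
    tiledCount κ R C a b ≤ tiledCount κ R C (a + a') b :=
  (Nat.le_mul_of_pos_right _ (tiledCount_pos h _ _)).trans
    (tiledCount_mul_le_add_left κ R C a a' b)

theorem tiledCount_le_add (h : 0 < marginCount κ R C) (a a' b b' : ℕ) :
    tiledCount κ R C a b ≤ tiledCount κ R C (a + a') (b + b') := by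
  refine (tiledCount_le_add_left h a a' b).trans ?_
  rw [tiledCount_swap κ R C, tiledCount_swap κ R C]
  exact tiledCount_le_add_left (marginCount_swap κ R C ▸ h) b b' (a + a')

theorem tiledCount_pow_le (κ : ℕ∞) (R : I → ℕ) (C : J → ℕ) (k q : ℕ) :
    tiledCount κ R C k k ^ (q * q) ≤ tiledCount κ R C (q * k) (q * k) := by
  have h := prod_marginCount_le κ
    (fun (_ _ : Fin q) (p : Fin k × I) => k * R p.2)
    (fun (_ _ : Fin q) (p : Fin k × J) => k * C p.2)
  simp only [Finset.prod_const, Finset.card_univ, Fintype.card_fin, ← pow_mul, Finset.sum_const,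
    smul_eq_mul] at h
  rw [tiledCount, tiledCount, ← marginCount_comp_equiv κ (fun p : Fin (q * k) × I => _) _
    ((Equiv.prodAssoc _ _ _).symm.trans (finProdFinEquiv.prodCongr (Equiv.refl I)))
    ((Equiv.prodAssoc _ _ _).symm.trans (finProdFinEquiv.prodCongr (Equiv.refl J)))]
  refine h.trans_eq ?_
  congr 1 <;> funext p <;> simp [mul_assoc]

theorem tiledCount_le_two_pow (κ : ℕ∞) (R : I → ℕ) (C : J → ℕ) (s : ℕ) :
    tiledCount κ R C s s ≤ 2 ^ ((Fintype.card I * Fintype.card J + ∑ i, R i) * s ^ 2) := by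
  refine (marginCount_le_knomial _ _ _).trans ((knomial_le_two_pow _ _ _).trans_eq ?_)
  simp only [Fintype.card_prod, Fintype.card_fin, Fintype.sum_prod_type, Finset.sum_const,
    Finset.card_univ, smul_eq_mul, ← Finset.mul_sum]
  ring

theorem exists_tendsto_log_tiledCount (h : 0 < marginCount κ R C) :
    ∃ L, Tendsto (fun s : ℕ => Real.log (tiledCount κ R C s s) / (s : ℝ) ^ 2) atTop (𝓝 L) ∧
      ∀ k : ℕ, Real.log (tiledCount κ R C k k) / (k : ℝ) ^ 2 ≤ L := by
  have hpos : ∀ k, (0 : ℝ) < tiledCount κ R C k k := fun k => by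
    exact_mod_cast tiledCount_pos h k k
  refine exists_tendsto_div_pow
    (B := (Fintype.card I * Fintype.card J + ∑ i, R i : ℕ) * Real.log 2)
    (fun s => ?_) fun k q t => ?_
  · refine (Real.log_le_log (hpos s) (Nat.cast_le.2 (tiledCount_le_two_pow κ R C s))).trans_eq ?_
    rw [Nat.cast_pow, Real.log_pow]
    push_cast
    ring
  · rw [pow_two, ← Nat.cast_mul, ← Real.log_pow]
    refine Real.log_le_log (pow_pos (hpos k) _) ?_
    exact_mod_cast (tiledCount_pow_le κ R C k q).trans (tiledCount_le_add h _ _ _ _)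

theorem prod_marginCount_const_le_tiledCount (κ : ℕ∞) {q : ℕ} {t : I → J → ℕ}
    (hR : ∀ i, ∑ j, t i j = q * R i) (hC : ∀ j, ∑ i, t i j = q * C j) :
    ∏ i, ∏ j, marginCount κ (fun _ : Fin q × Fin q => q * t i j)
      (fun _ : Fin q × Fin q => q * t i j) ≤ tiledCount κ R C (q * q) (q * q) := by
  refine (prod_marginCount_le κ (fun i j (_ : Fin q × Fin q) => q * t i j)
    (fun i j (_ : Fin q × Fin q) => q * t i j)).trans_eq ?_
  rw [tiledCount, ← marginCount_comp_equiv κ (fun p : Fin (q * q) × I => _) _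
    ((Equiv.prodComm _ _).trans (finProdFinEquiv.prodCongr (Equiv.refl I)))
    ((Equiv.prodComm _ _).trans (finProdFinEquiv.prodCongr (Equiv.refl J)))]
  congr 1 <;> funext p <;> simp [← Finset.mul_sum, hR, hC, mul_assoc]

theorem marginCount_const_pos {q r : ℕ} [NeZero q] (hk : 0 < knomial κ (q * q) r) :
    0 < marginCount κ (fun _ : Fin q × Fin q => r) (fun _ : Fin q × Fin q => r) :=
  Nat.pos_of_mul_pos_left ((pow_pos hk _).trans_le (knomial_pow_le_marginCount_const κ q r))

theorem log_knomial_sub_le_log_marginCount_const {q r : ℕ} [NeZero q]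
    (hk : 0 < knomial κ (q * q) r) :
    Real.log (knomial κ (q * q) r) / (q : ℝ) ^ 2 - 2 * (Real.log (r + 1) / q) ≤
      Real.log (marginCount κ (fun _ : Fin q × Fin q => r) (fun _ : Fin q × Fin q => r)) /
        ((q * q : ℕ) : ℝ) ^ 2 := by
  have hq := NeZero.pos q
  have hM := Nat.cast_pos (α := ℝ).2 (marginCount_const_pos hk)
  have hk' := Nat.cast_pos (α := ℝ).2 hk
  have hpow : (knomial κ (q * q) r : ℝ) ^ (q * q) ≤ (r + 1 : ℝ) ^ (2 * q * (q * q)) *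
      marginCount κ (fun _ : Fin q × Fin q => r) (fun _ : Fin q × Fin q => r) := by
    exact_mod_cast knomial_pow_le_marginCount_const κ q r
  have hlog := Real.log_le_log (pow_pos hk' _) hpow
  rw [Real.log_mul (by positivity) hM.ne', Real.log_pow, Real.log_pow] at hlog
  rw [le_div_iff₀ (by positivity)]
  push_cast at hlog ⊢
  calc _ = (q : ℝ) * q * Real.log (knomial κ (q * q) r) -
        2 * q * (q * q) * Real.log (r + 1) := by field_simp
    _ ≤ _ := by linarith

theorem sum_log_knomial_le_log_tiledCount {q : ℕ} [NeZero q] {t : I → J → ℕ}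
    (hR : ∀ i, ∑ j, t i j = q * R i) (hC : ∀ j, ∑ i, t i j = q * C j)
    (hk : ∀ i j, 0 < knomial κ (q * q) (q * t i j)) :
    ∑ i, ∑ j, (Real.log (knomial κ (q * q) (q * t i j)) / (q : ℝ) ^ 2 -
        2 * (Real.log ((q * t i j : ℕ) + 1) / q)) ≤
      Real.log (tiledCount κ R C (q * q) (q * q)) / ((q * q : ℕ) : ℝ) ^ 2 := by
  let M (i : I) (j : J) : ℕ :=
    marginCount κ (fun _ : Fin q × Fin q => q * t i j) (fun _ : Fin q × Fin q => q * t i j)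
  have hM : ∀ i j, (M i j : ℝ) ≠ 0 := fun i j =>
    Nat.cast_ne_zero.2 (marginCount_const_pos (hk i j)).ne'
  calc _ ≤ ∑ i, ∑ j, Real.log (M i j) / ((q * q : ℕ) : ℝ) ^ 2 :=
        Finset.sum_le_sum fun i _ => Finset.sum_le_sum fun j _ =>
          log_knomial_sub_le_log_marginCount_const (hk i j)
    _ = Real.log (∏ i, ∏ j, M i j : ℕ) / ((q * q : ℕ) : ℝ) ^ 2 := by
      push_cast
      rw [Real.log_prod fun i _ => Finset.prod_ne_zero_iff.2 fun j _ => hM i j]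
      simp only [Real.log_prod fun j _ => hM _ j, Finset.sum_div]
    _ ≤ _ := by
      gcongr
      · exact Nat.cast_pos.2 (Finset.prod_pos fun i _ => Finset.prod_pos fun j _ =>
          marginCount_const_pos (hk i j))
      · exact prod_marginCount_const_le_tiledCount κ hR hC

theorem tendsto_log_knomial_square {N r : ℕ} {E : ℝ} (hN : N ≠ 0)
    (h : Tendsto (fun s : ℕ => Real.log (knomial κ (s * N) (s * r)) / s) atTop (𝓝 (N * E))) :
    Tendsto (fun p : ℕ => Real.log (knomial κ (N * p * (N * p)) (N * p * (p * r))) /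
      ((N * p : ℕ) : ℝ) ^ 2) atTop (𝓝 E) := by
  have hs : Tendsto (fun p : ℕ => N * p ^ 2) atTop atTop :=
    (tendsto_pow_atTop two_ne_zero).const_mul_atTop' hN.bot_lt
  have h := (h.comp hs).div_const (N : ℝ)
  rw [mul_div_cancel_left₀ _ (Nat.cast_ne_zero.2 hN)] at h
  refine h.congr fun p => ?_
  rw [Function.comp, div_div, show N * p * (N * p) = N * p ^ 2 * N by ring,
    show N * p * (p * r) = N * p ^ 2 * r by ring]
  push_cast
  ring

theorem tendsto_two_mul_log_succ_div {N : ℕ} (hN : N ≠ 0) (r : ℕ) :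
    Tendsto (fun p : ℕ => 2 * (Real.log ((N * p * (p * r) : ℕ) + 1) / (N * p : ℕ))) atTop
      (𝓝 0) := by
  have hN' : (N : ℝ) ≠ 0 := Nat.cast_ne_zero.2 hN
  have h := tendsto_log_div_natCast_of_le_mul_pow
    (u := fun p => (N * p * (p * r) : ℕ) + 1) (c := N * r + 1) (d := 2)
    (fun p => le_add_of_nonneg_left (Nat.cast_nonneg _)) fun p hp => by
      have hp1 : (1 : ℝ) ≤ (p : ℝ) ^ 2 := one_le_pow₀ (Nat.one_le_cast.2 hp.bot_lt)
      push_cast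
      linarith
  rw [← mul_zero (2 / N : ℝ)]
  refine (h.const_mul (2 / N : ℝ)).congr fun p => ?_
  rw [Nat.cast_mul N p]
  field_simp

theorem sum_rate_le_of_tendsto_log_knomial {N : ℕ} (hN : N ≠ 0) (hR : ∑ i, R i = N)
    (hC : ∑ j, C j = N) {L : ℝ}
    (hL : ∀ k : ℕ, Real.log (tiledCount κ R C k k) / (k : ℝ) ^ 2 ≤ L)
    {E : I → J → ℝ} (hk : ∀ s i j, 0 < knomial κ (s * N) (s * (R i * C j)))
    (hE : ∀ i j, Tendsto (fun s : ℕ => Real.log (knomial κ (s * N) (s * (R i * C j))) / s) atTop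
      (𝓝 (N * E i j))) :
    ∑ i, ∑ j, E i j ≤ L := by
  have hlim := tendsto_finsetSum Finset.univ fun i _ => tendsto_finsetSum Finset.univ fun j _ =>
    (tendsto_log_knomial_square hN (hE i j)).sub (tendsto_two_mul_log_succ_div hN (R i * C j))
  simp only [sub_zero] at hlim
  refine le_of_tendsto hlim ?_
  filter_upwards [eventually_ne_atTop 0] with p hp
  have : NeZero (N * p) := ⟨mul_ne_zero hN hp⟩
  refine (sum_log_knomial_le_log_tiledCount (t := fun i j => p * (R i * C j))
    (fun i => ?_) (fun j => ?_) (fun i j => ?_)).trans (hL _)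
  · rw [← Finset.mul_sum, ← Finset.mul_sum, hC]; ring
  · rw [← Finset.mul_sum, ← Finset.sum_mul, hR]; ring
  · convert hk (N * p ^ 2) i j using 2 <;> ring

end Tiling

theorem le_two_mul_sum_Icc_of_tilts {c : ℕ → ℝ} {η θ S T U : ℝ} {A B : ℕ} (hc : ∀ r, 0 ≤ c r)
    (hη : 0 < η) (hη1 : η ≤ 1) (hθ : 1 ≤ θ) (hS : HasSum c S)
    (hT : HasSum (fun r => c r * θ ^ r) T) (hU : HasSum (fun r => c r * η ^ r) U)
    (h : T / θ ^ B + U / η ^ A ≤ S / 2) : S ≤ 2 * ∑ r ∈ Finset.Icc A B, c r := by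
  have : 0 < θ := one_pos.trans_le hθ
  have hpoint : ∀ r, c r ≤ (if r ∈ Finset.Icc A B then c r else 0) +
      (c r * θ ^ r / θ ^ B + c r * η ^ r / η ^ A) := by
    intro r
    have hT0 : 0 ≤ c r * θ ^ r / θ ^ B := by have := hc r; positivity
    have hU0 : 0 ≤ c r * η ^ r / η ^ A := by have := hc r; positivity
    by_cases hr : r ∈ Finset.Icc A B
    · rw [if_pos hr]
      linarith
    rw [if_neg hr, zero_add]
    rcases lt_or_ge r A with hrA | hrA
    · have hle : c r ≤ c r * η ^ r / η ^ A := by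
        rw [le_div_iff₀ (by positivity)]
        exact mul_le_mul_of_nonneg_left (pow_le_pow_of_le_one hη.le hη1 hrA.le) (hc r)
      linarith
    · have hrB : B ≤ r := by
        rw [Finset.mem_Icc, not_and, not_le] at hr
        exact (hr hrA).le
      have hle : c r ≤ c r * θ ^ r / θ ^ B := by
        rw [le_div_iff₀ (by positivity)]
        exact mul_le_mul_of_nonneg_left (pow_le_pow_right₀ hθ hrB) (hc r)
      linarith
  have hwindow : HasSum (fun r => if r ∈ Finset.Icc A B then c r else 0)
      (∑ r ∈ Finset.Icc A B, c r) := by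
    rw [Finset.sum_congr rfl fun r hr => (if_pos hr).symm]
    exact hasSum_sum_of_ne_finset_zero fun r hr => if_neg hr
  have hsum := hasSum_le hpoint hS
    (hwindow.add ((hT.div_const (θ ^ B)).add (hU.div_const (η ^ A))))
  linarith

theorem exists_mem_Icc_le_of_tilts {c : ℕ → ℝ} {η θ S T U : ℝ} {A B : ℕ} (hAB : A ≤ B)
    (hc : ∀ r, 0 ≤ c r) (hη : 0 < η) (hη1 : η ≤ 1) (hθ : 1 ≤ θ) (hS : HasSum c S)
    (hT : HasSum (fun r => c r * θ ^ r) T) (hU : HasSum (fun r => c r * η ^ r) U)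
    (h : T / θ ^ B + U / η ^ A ≤ S / 2) : ∃ r ∈ Finset.Icc A B, S ≤ 2 * (B + 1) * c r := by
  obtain ⟨r, hr, hmax⟩ := Finset.exists_max_image _ c (Finset.nonempty_Icc.2 hAB)
  refine ⟨r, hr, (le_two_mul_sum_Icc_of_tilts hc hη hη1 hθ hS hT hU h).trans ?_⟩
  have hcard : ((Finset.Icc A B).card : ℝ) ≤ B + 1 := by
    rw [Nat.card_Icc]
    exact_mod_cast Nat.sub_le _ _
  rw [mul_assoc]
  gcongr
  refine (Finset.sum_le_card_nsmul _ _ _ hmax).trans ?_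
  rw [nsmul_eq_mul]
  exact mul_le_mul_of_nonneg_right hcard (hc r)

section Tilt

variable {F : ℝ → ℝ} {z : ℝ} {n e : ℕ}

theorem hasDerivAt_tilt (hF : DifferentiableAt ℝ F z) (hFz : F z ≠ 0) (n e : ℕ) :
    HasDerivAt (fun θ => F (z * θ) ^ n / θ ^ e) (F z ^ n * (n * (z * logDeriv F z) - e)) 1 := by
  have hinner : HasDerivAt (fun θ => F (z * θ)) (deriv F z * (z * 1)) 1 :=
    HasDerivAt.comp (h₂ := F) 1 (by rw [mul_one]; exact hF.hasDerivAt)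
      ((hasDerivAt_id (1 : ℝ)).const_mul z)
  refine ((hinner.fun_pow n).fun_div (hasDerivAt_pow e (1 : ℝ)) (by simp)).congr_deriv ?_
  rw [logDeriv_apply]
  cases n with
  | zero => simp
  | succ n =>
    simp only [mul_one, one_pow, Nat.add_sub_cancel]
    field_simp
    ring

theorem exists_one_lt_tilt_lt (hF : DifferentiableAt ℝ F z) (hFz : 0 < F z) (hz : z < 1)
    (he : n * (z * logDeriv F z) < e) :
    ∃ θ, 1 < θ ∧ z * θ < 1 ∧ F (z * θ) ^ n / θ ^ e < F z ^ n := by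
  have hderiv := eventually_nhdsGT_lt_of_hasDerivAt_neg (hasDerivAt_tilt hF hFz.ne' n e)
    (mul_neg_of_pos_of_neg (pow_pos hFz n) (sub_neg.2 he))
  have hdomain : ∀ᶠ θ in 𝓝[>] (1 : ℝ), z * θ < 1 :=
    nhdsWithin_le_nhds <| (continuous_const_mul z).continuousAt.eventually
      (gt_mem_nhds (by simpa using hz))
  obtain ⟨θ, ⟨hlt, hθ⟩, hθ1⟩ := ((hderiv.and hdomain).and self_mem_nhdsWithin).exists
  exact ⟨θ, hθ1, hθ, by simpa using hlt⟩

theorem exists_lt_one_tilt_lt (hF : DifferentiableAt ℝ F z) (hFz : 0 < F z)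
    (he : e < n * (z * logDeriv F z)) :
    ∃ η, 0 < η ∧ η < 1 ∧ F (z * η) ^ n / η ^ e < F z ^ n := by
  have hderiv := eventually_nhdsLT_lt_of_hasDerivAt_pos (hasDerivAt_tilt hF hFz.ne' n e)
    (mul_pos (pow_pos hFz n) (sub_pos.2 he))
  obtain ⟨η, ⟨hlt, hη⟩, hη1⟩ := ((hderiv.and
    (nhdsWithin_le_nhds (lt_mem_nhds one_pos))).and self_mem_nhdsWithin).exists
  exact ⟨η, hη, hη1, by simpa using hlt⟩

end Tilt

theorem eventually_pow_add_pow_le {a b c : ℝ} (ha : 0 ≤ a) (hac : a < c) (hb : 0 ≤ b)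
    (hbc : b < c) : ∀ᶠ p : ℕ in atTop, a ^ p + b ^ p ≤ c ^ p / 2 := by
  have hc : 0 < c := ha.trans_lt hac
  have hratio : ∀ {w : ℝ}, 0 ≤ w → w < c → Tendsto (fun p : ℕ => (w / c) ^ p) atTop (𝓝 0) :=
    fun hw hwc => tendsto_pow_atTop_nhds_zero_of_lt_one (by positivity) ((div_lt_one hc).2 hwc)
  have hsum := (hratio ha hac).add (hratio hb hbc)
  rw [add_zero] at hsum
  filter_upwards [hsum.eventually_le_const one_half_pos] with p hp
  rwa [div_pow, div_pow, ← add_div, div_le_iff₀ (by positivity), one_div_mul_eq_div] at hp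

theorem tendsto_log_two_mul_succ_div (b : ℕ) :
    Tendsto (fun p : ℕ => Real.log (2 * ((p * b : ℕ) + 1)) / p) atTop (𝓝 0) := by
  refine tendsto_log_div_natCast_of_le_mul_pow (c := 2 * (b + 1)) (d := 1)
    (fun p => ?_) fun p hp => ?_
  · have : (0 : ℝ) ≤ (p * b : ℕ) := Nat.cast_nonneg _
    linarith
  · have : (1 : ℝ) ≤ p := Nat.one_le_cast.2 (Nat.pos_of_ne_zero hp)
    push_cast
    linarith

section Cramer

variable {κ : ℕ∞} {z : ℝ}

theorem eventually_exists_knomialGF_pow_le (h0 : 0 < z) (h1 : z < 1)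
    (hF : DifferentiableAt ℝ (knomialGF κ) z) {n A B : ℕ}
    (hA : A < n * (z * logDeriv (knomialGF κ) z)) (hB : n * (z * logDeriv (knomialGF κ) z) < B) :
    ∀ᶠ p : ℕ in atTop, ∃ r ∈ Finset.Icc (p * A) (p * B),
      knomialGF κ z ^ (p * n) ≤ 2 * ((p * B : ℕ) + 1) * (knomial κ (p * n) r * z ^ r) := by
  have hFz : 0 < knomialGF κ z := one_pos.trans_le (one_le_knomialGF κ h0.le h1)
  obtain ⟨θ, hθ, hzθ, hθF⟩ := exists_one_lt_tilt_lt hF hFz h1 hB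
  obtain ⟨η, hη, hη1, hηF⟩ := exists_lt_one_tilt_lt hF hFz hA
  have hzη : z * η < 1 := (mul_lt_of_lt_one_right h0 hη1).trans h1
  have hθ0 : 0 < θ := one_pos.trans hθ
  have hnonneg : ∀ {w : ℝ}, 0 ≤ w → w < 1 → 0 ≤ knomialGF κ w := fun hw hw1 =>
    zero_le_one.trans (one_le_knomialGF κ hw hw1)
  have hFθ := hnonneg (mul_pos h0 hθ0).le hzθ
  have hFη := hnonneg (mul_pos h0 hη).le hzη
  have hAB : A ≤ B := Nat.cast_le.1 (hA.trans hB).le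
  have htilt : ∀ {x : ℝ} (p : ℕ), 0 ≤ z * x → z * x < 1 →
      HasSum (fun r => knomial κ (p * n) r * z ^ r * x ^ r) (knomialGF κ (z * x) ^ (p * n)) := by
    intro x p hx hx1
    simpa only [mul_pow, mul_assoc] using hasSum_knomial κ hx hx1 (p * n)
  filter_upwards [eventually_pow_add_pow_le (by positivity) hθF (by positivity) hηF] with p hp
  refine exists_mem_Icc_le_of_tilts (Nat.mul_le_mul_left p hAB) (fun r => by positivity) hη hη1.le
    hθ.le (hasSum_knomial κ h0.le h1 (p * n)) (htilt p (by positivity) hzθ)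
    (htilt p (by positivity) hzη) ?_
  simpa only [mul_comm p, pow_mul, div_pow] using hp

variable {n r : ℕ}

theorem knomial_dilate_pos {K : ℕ} (hK : (K : ℕ∞) ≤ κ) (hrn : r ≤ K * n) (s : ℕ) :
    0 < knomial κ (s * n) (s * r) :=
  knomial_pos hK ((Nat.mul_le_mul_left s hrn).trans_eq (Nat.mul_left_comm ..))

theorem knomial_le_of_mem_Icc {K p Q r' : ℕ} (hK : (K : ℕ∞) ≤ κ) (hr : 0 < r) (hrn : r < K * n)
    (hr' : r' ∈ Finset.Icc (p * (Q * r - 1)) (p * (Q * r + 1))) :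
    knomial κ (p * (Q * n)) r' ≤ knomial κ (p * (Q + 1) * n) (p * (Q + 1) * r) := by
  obtain ⟨hlower, hupper⟩ := Finset.mem_Icc.1 hr'
  have hupper' : r' ≤ p * (Q + 1) * r := by nlinarith
  have hrest : p * (Q + 1) * r - r' ≤ K * (p * n) := by
    have : p * (r + 1) ≤ p * (K * n) := Nat.mul_le_mul_left p hrn
    have : p * (Q * r) ≤ p * (Q * r - 1) + p := by
      rw [← Nat.mul_succ]
      exact Nat.mul_le_mul_left p (by omega)
    rw [Nat.sub_le_iff_le_add]
    linarith
  calc knomial κ (p * (Q * n)) r'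
      ≤ knomial κ (p * (Q * n)) r' * knomial κ (p * n) (p * (Q + 1) * r - r') :=
        Nat.le_mul_of_pos_right _ (knomial_pos hK hrest)
    _ ≤ knomial κ (p * (Q * n) + p * n) (r' + (p * (Q + 1) * r - r')) := knomial_mul_le ..
    _ = knomial κ (p * (Q + 1) * n) (p * (Q + 1) * r) := by
        rw [Nat.add_sub_cancel' hupper']
        congr 1
        ring

/-- With overwhelming tilted mass a product of `p * Q * n` factors has degree within `p` of its mean
`p * Q * r`; multiplying by `p * n` further factors repairs the deviation. -/
theorem mul_add_log_le_of_tendsto_log_knomial {K : ℕ} (hK : (K : ℕ∞) ≤ κ) (hr : 0 < r)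
    (hrn : r < K * n) (h0 : 0 < z) (h1 : z < 1) (hF : DifferentiableAt ℝ (knomialGF κ) z)
    (hz : n * (z * logDeriv (knomialGF κ) z) = r) {L : ℝ}
    (hL : Tendsto (fun s : ℕ => Real.log (knomial κ (s * n) (s * r)) / s) atTop (𝓝 L))
    {Q : ℕ} (hQ : 0 < Q) :
    Q * (n * Real.log (knomialGF κ z) - r * Real.log z) + Real.log z ≤ (Q + 1) * L := by
  have hFz : 0 < knomialGF κ z := one_pos.trans_le (one_le_knomialGF κ h0.le h1)
  have hQr : 1 ≤ Q * r := Nat.mul_pos hQ hr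
  have hmean : ((Q * n : ℕ) : ℝ) * (z * logDeriv (knomialGF κ) z) = Q * r := by
    rw [Nat.cast_mul, mul_assoc, hz]
  have hev := eventually_exists_knomialGF_pow_le (n := Q * n) (A := Q * r - 1) (B := Q * r + 1)
    h0 h1 hF (by rw [hmean]; push_cast [hQr]; linarith) (by rw [hmean]; push_cast; linarith)
  have hsub : Tendsto (fun p : ℕ => p * (Q + 1)) atTop atTop :=
    tendsto_id.atTop_mul_const' Q.succ_pos
  have hlim := (tendsto_log_two_mul_succ_div (Q * r + 1)).add
    ((hL.comp hsub).const_mul ((Q : ℝ) + 1))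
  rw [zero_add] at hlim
  refine ge_of_tendsto hlim ?_
  filter_upwards [hev, eventually_gt_atTop 0] with p ⟨r', hr', hle⟩ hp
  have hp' : (0 : ℝ) < p := Nat.cast_pos.2 hp
  have hlower := (Finset.mem_Icc.1 hr').1
  have hk : (0 : ℝ) < knomial κ (p * (Q + 1) * n) (p * (Q + 1) * r) :=
    Nat.cast_pos.2 (knomial_dilate_pos hK hrn.le _)
  have hbound : knomialGF κ z ^ (p * (Q * n)) ≤ 2 * ((p * (Q * r + 1) : ℕ) + 1) *
      (knomial κ (p * (Q + 1) * n) (p * (Q + 1) * r) * z ^ (p * (Q * r - 1))) :=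
    hle.trans <| mul_le_mul_of_nonneg_left
      (mul_le_mul (mod_cast knomial_le_of_mem_Icc hK hr hrn hr')
        (pow_le_pow_of_le_one h0.le h1.le hlower) (by positivity) hk.le) (by positivity)
  have hlog := Real.log_le_log (by positivity) hbound
  rw [Real.log_mul (by positivity) (by positivity), Real.log_mul hk.ne' (by positivity),
    Real.log_pow, Real.log_pow] at hlog
  rw [Nat.cast_mul p (Q * r - 1), Nat.cast_pred hQr] at hlog
  have hscale : ∀ w : ℝ, ((Q : ℝ) + 1) * (w / ((p * (Q + 1) : ℕ) : ℝ)) = w / p := by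
    intro w
    push_cast
    field_simp
  simp only [Function.comp]
  rw [hscale, ← add_div, le_div_iff₀ hp']
  push_cast at hlog ⊢
  linarith

theorem log_knomial_le (h0 : 0 < z) (h1 : z < 1) (hk : 0 < knomial κ n r) :
    Real.log (knomial κ n r) ≤ n * Real.log (knomialGF κ z) - r * Real.log z := by
  have hk' : (0 : ℝ) < knomial κ n r := Nat.cast_pos.2 hk
  have hlog := Real.log_le_log (by positivity) (knomial_mul_pow_le κ h0.le h1 n r)
  rw [Real.log_mul hk'.ne' (by positivity), Real.log_pow, Real.log_pow] at hlog
  linarith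

theorem mul_log_knomial_dilate_le {K : ℕ} (hK : (K : ℕ∞) ≤ κ) (hrn : r ≤ K * n) (k q t : ℕ) :
    q * Real.log (knomial κ (k * n) (k * r)) ≤
      Real.log (knomial κ ((q * k + t) * n) ((q * k + t) * r)) := by
  have hpos := fun s => knomial_dilate_pos hK hrn s
  rw [← Real.log_pow]
  refine Real.log_le_log (pow_pos (Nat.cast_pos.2 (hpos k)) q) ?_
  norm_cast
  calc knomial κ (k * n) (k * r) ^ q
      ≤ knomial κ (q * (k * n)) (q * (k * r)) := knomial_pow_le ..
    _ ≤ knomial κ (q * (k * n)) (q * (k * r)) * knomial κ (t * n) (t * r) :=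
        Nat.le_mul_of_pos_right _ (hpos t)
    _ ≤ knomial κ (q * (k * n) + t * n) (q * (k * r) + t * r) := knomial_mul_le ..
    _ = knomial κ ((q * k + t) * n) ((q * k + t) * r) := by
        congr 1 <;> ring

theorem tendsto_log_knomial {K : ℕ} (hK : (K : ℕ∞) ≤ κ) (hr : 0 < r) (hrn : r < K * n)
    (h0 : 0 < z) (h1 : z < 1) (hz : n * (z * logDeriv (knomialGF κ) z) = r) :
    Tendsto (fun s : ℕ => Real.log (knomial κ (s * n) (s * r)) / s) atTop
      (𝓝 (n * Real.log (knomialGF κ z) - r * Real.log z)) := by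
  have hF : DifferentiableAt ℝ (knomialGF κ) z := by
    refine differentiableAt_of_deriv_ne_zero fun h => ?_
    rw [logDeriv_apply, h, zero_div, mul_zero, mul_zero] at hz
    exact hr.ne (Nat.cast_injective (R := ℝ) (by rwa [Nat.cast_zero]))
  have hupper : ∀ s : ℕ, Real.log (knomial κ (s * n) (s * r)) ≤
      (n * Real.log (knomialGF κ z) - r * Real.log z) * s := by
    intro s
    have hle := log_knomial_le h0 h1 (knomial_dilate_pos hK hrn.le s)
    push_cast at hle
    linarith
  obtain ⟨L, hL, -⟩ := exists_tendsto_div_pow (d := 1)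
    (u := fun s => Real.log (knomial κ (s * n) (s * r))) (by simpa only [pow_one] using hupper)
    (by simpa only [pow_one] using mul_log_knomial_dilate_le hK hrn.le)
  simp only [pow_one] at hL
  suffices h : n * Real.log (knomialGF κ z) - r * Real.log z = L by rwa [h]
  refine le_antisymm ?_ (le_of_tendsto hL ?_)
  · have hlin : ∀ Q : ℕ, 0 < Q →
        n * Real.log (knomialGF κ z) - r * Real.log z - L ≤ (L - Real.log z) / Q := by
      intro Q hQ
      rw [le_div_iff₀ (Nat.cast_pos.2 hQ)]
      linarith [mul_add_log_le_of_tendsto_log_knomial hK hr hrn h0 h1 hF hz hL hQ]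
    exact sub_nonpos.1 <| ge_of_tendsto (tendsto_const_div_atTop_nhds_zero_nat (L - Real.log z))
      ((eventually_gt_atTop 0).mono hlin)
  · filter_upwards [eventually_gt_atTop 0] with s hs
    exact (div_le_iff₀ (Nat.cast_pos.2 hs)).2 (hupper s)

end Cramer

section Dilation

variable {I : Type*} [Fintype I] {H : ℝ → ℝ} {u : I → ℝ}

/-- The gap between the sum of the values of `H` at the dilates `u i * y` and the value of that
sum for the constant weights `u = 1`. -/
noncomputable def dilationDefect (H : ℝ → ℝ) (u : I → ℝ) (y : ℝ) : ℝ :=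
  ∑ i, H (u i * y) - Fintype.card I * H y

theorem sum_inv_card_smul_eq_div_card (f : I → ℝ) :
    ∑ i, (Fintype.card I : ℝ)⁻¹ • f i = (∑ i, f i) / Fintype.card I := by
  rw [← Finset.smul_sum, smul_eq_mul, inv_mul_eq_div]

theorem sum_inv_card_eq_one [Nonempty I] : ∑ _i : I, (Fintype.card I : ℝ)⁻¹ = 1 := by
  simp

theorem eq_one_of_sum_eq_card (hsum : ∑ i, u i = Fintype.card I) (hu : ∀ i i', u i = u i')
    (i : I) : u i = 1 := by
  have : Nonempty I := ⟨i⟩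
  rw [Finset.sum_congr rfl fun i' _ => hu i' i, Finset.sum_const, Finset.card_univ,
    nsmul_eq_mul] at hsum
  exact mul_left_cancel₀ (Nat.cast_ne_zero.2 Fintype.card_ne_zero) (by rw [hsum, mul_one])

theorem dilationDefect_pos {s : Set ℝ} (hH : StrictConvexOn ℝ s H)
    (hsum : ∑ i, u i = Fintype.card I) (hne : ∃ i i', u i ≠ u i') {x : ℝ} (hx : x ≠ 0)
    (hmem : ∀ i, u i * x ∈ s) : 0 < dilationDefect H u x := by
  obtain ⟨i, i', hii'⟩ := hne
  have : Nonempty I := ⟨i⟩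
  have hcard : (0 : ℝ) < Fintype.card I := Nat.cast_pos.2 Fintype.card_pos
  have h := hH.map_sum_lt (t := Finset.univ) (w := fun _ : I => (Fintype.card I : ℝ)⁻¹)
    (p := fun i => u i * x) (fun _ _ => inv_pos.2 hcard) sum_inv_card_eq_one
    (fun i _ => hmem i)
    ⟨i, Finset.mem_univ i, i', Finset.mem_univ i', fun h => hii' (mul_right_cancel₀ hx h)⟩
  rw [sum_inv_card_smul_eq_div_card, sum_inv_card_smul_eq_div_card, ← Finset.sum_mul, hsum,
    mul_div_cancel_left₀ _ hcard.ne', lt_div_iff₀' hcard] at h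
  exact sub_pos.2 h

theorem hasDerivAt_sum_mul_comp_mul (w : I → ℝ) {y : ℝ}
    (hH : ∀ i, u i ≠ 0 → DifferentiableAt ℝ H (u i * y)) :
    HasDerivAt (fun y => ∑ i, w i * H (u i * y)) (∑ i, w i * (u i * deriv H (u i * y))) y := by
  refine HasDerivAt.fun_sum fun i _ => HasDerivAt.const_mul _ ?_
  rcases eq_or_ne (u i) 0 with hi | hi
  · simpa only [hi, zero_mul] using hasDerivAt_const y (H 0)
  · rw [mul_comm (u i) (deriv _ _)]
    exact (hH i hi).hasDerivAt.comp y (hasDerivAt_const_mul (u i))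

end Dilation

/-- The convexity property of an entropy `H` at the bottom of its domain `[0, b)` which makes its
dilation defects convex: the strict convexity of `x ^ 2 * H'' x`. -/
structure StrictDilationConvex (H : ℝ → ℝ) (b : ℝ) : Prop where
  continuousOn : ContinuousOn H (Set.Ico 0 b)
  differentiableAt : ∀ x ∈ Set.Ioo 0 b, DifferentiableAt ℝ H x
  differentiableAt_deriv : ∀ x ∈ Set.Ioo 0 b, DifferentiableAt ℝ (deriv H) x
  strictConvexOn : StrictConvexOn ℝ (Set.Ico 0 b) fun x => x ^ 2 * deriv (deriv H) x

namespace StrictDilationConvex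

variable {I J : Type*} [Fintype I] [Fintype J] {H : ℝ → ℝ} {b Y : ℝ} {u : I → ℝ} {y : J → ℝ}

theorem sq_mul_deriv2_dilationDefect (hH : StrictDilationConvex H b) (hu : ∀ i, 0 ≤ u i)
    (hY : ∀ i, u i * Y < b) (hYb : Y ≤ b) {x : ℝ} (hx : x ∈ Set.Ioo 0 Y) :
    x ^ 2 * deriv^[2] (dilationDefect H u) x =
      dilationDefect (fun t => t ^ 2 * deriv (deriv H) t) u x := by
  have hmem : ∀ t ∈ Set.Ioo 0 Y, ∀ i, u i ≠ 0 → u i * t ∈ Set.Ioo 0 b := fun t ht i hi =>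
    ⟨mul_pos ((hu i).lt_of_ne' hi) ht.1,
      (mul_le_mul_of_nonneg_left ht.2.le (hu i)).trans_lt (hY i)⟩
  have hb : ∀ t ∈ Set.Ioo 0 Y, t ∈ Set.Ioo 0 b := fun t ht => ⟨ht.1, ht.2.trans_le hYb⟩
  have hderiv : deriv (dilationDefect H u) =ᶠ[𝓝 x]
      fun t => ∑ i, u i * deriv H (u i * t) - Fintype.card I * deriv H t := by
    filter_upwards [Ioo_mem_nhds hx.1 hx.2] with t ht
    have hsum := hasDerivAt_sum_mul_comp_mul (fun _ => 1)
      fun i hi => hH.differentiableAt _ (hmem t ht i hi)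
    simp only [one_mul] at hsum
    exact (hsum.fun_sub ((hH.differentiableAt t (hb t ht)).hasDerivAt.const_mul _)).deriv
  have hderiv2 := (hasDerivAt_sum_mul_comp_mul u
    fun i hi => hH.differentiableAt_deriv _ (hmem x hx i hi)).fun_sub
      ((hH.differentiableAt_deriv x (hb x hx)).hasDerivAt.const_mul (Fintype.card I : ℝ))
  rw [Function.iterate_succ_apply, Function.iterate_one, hderiv.deriv_eq, hderiv2.deriv,
    dilationDefect, mul_sub, Finset.mul_sum]
  congr 1
  · exact Finset.sum_congr rfl fun i _ => by ring
  · ring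

theorem strictConvexOn_dilationDefect (hH : StrictDilationConvex H b) (hY0 : 0 ≤ Y)
    (hu : ∀ i, 0 ≤ u i) (hsum : ∑ i, u i = Fintype.card I) (hY : ∀ i, u i * Y < b)
    (hne : ∃ i i', u i ≠ u i') :
    StrictConvexOn ℝ (Set.Icc 0 Y) (dilationDefect H u) := by
  have hmem : ∀ i, ∀ x ∈ Set.Icc 0 Y, u i * x ∈ Set.Ico 0 b := fun i x hx =>
    ⟨mul_nonneg (hu i) hx.1, (mul_le_mul_of_nonneg_left hx.2 (hu i)).trans_lt (hY i)⟩
  have hYb : Y < b := by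
    have : Nonempty I := ⟨hne.choose⟩
    obtain ⟨i, -, hi⟩ := Finset.exists_le_of_sum_le (f := fun _ : I => (1 : ℝ)) (g := u)
      Finset.univ_nonempty (by simp [hsum])
    exact (le_mul_of_one_le_left hY0 hi).trans_lt (hY i)
  have hcont : ContinuousOn (dilationDefect H u) (Set.Icc 0 Y) := by
    refine (continuousOn_finsetSum _ fun i _ => ?_).sub (continuousOn_const.mul ?_)
    · exact hH.continuousOn.comp (by fun_prop) (hmem i)
    · exact hH.continuousOn.mono (Set.Icc_subset_Ico_right hYb)
  refine strictConvexOn_of_deriv2_pos (convex_Icc 0 Y) hcont fun x hx => ?_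
  rw [interior_Icc] at hx
  refine pos_of_mul_pos_right (a := x ^ 2) ?_ (sq_nonneg x)
  rw [hH.sq_mul_deriv2_dilationDefect hu hY hYb.le hx]
  exact dilationDefect_pos hH.strictConvexOn hsum hne hx.1.ne' fun i =>
    hmem i x (Set.Ioo_subset_Icc_self hx)

theorem convexOn_dilationDefect (hH : StrictDilationConvex H b) (hY0 : 0 ≤ Y)
    (hu : ∀ i, 0 ≤ u i) (hsum : ∑ i, u i = Fintype.card I) (hY : ∀ i, u i * Y < b) :
    ConvexOn ℝ (Set.Icc 0 Y) (dilationDefect H u) := by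
  by_cases hne : ∃ i i', u i ≠ u i'
  · exact (hH.strictConvexOn_dilationDefect hY0 hu hsum hY hne).convexOn
  · push Not at hne
    have hzero : dilationDefect H u = fun _ => 0 := by
      ext x
      simp [dilationDefect, eq_one_of_sum_eq_card hsum hne]
    rw [hzero]
    exact convexOn_const 0 (convex_Icc 0 Y)

theorem card_mul_dilationDefect_le [Nonempty J] (hH : StrictDilationConvex H b)
    (hu : ∀ i, 0 ≤ u i) (hsum : ∑ i, u i = Fintype.card I) (hy : ∀ j, 0 ≤ y j)
    (huy : ∀ i j, u i * y j < b) :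
    Fintype.card J * dilationDefect H u ((∑ j, y j) / Fintype.card J) ≤
      ∑ j, dilationDefect H u (y j) := by
  obtain ⟨j₀, hj₀⟩ := Finite.exists_max y
  have h := (hH.convexOn_dilationDefect (hy j₀) hu hsum fun i => huy i j₀).map_sum_le
    (t := Finset.univ) (w := fun _ : J => (Fintype.card J : ℝ)⁻¹) (p := y)
    (fun _ _ => by positivity) sum_inv_card_eq_one fun j _ => ⟨hy j, hj₀ j⟩
  rwa [sum_inv_card_smul_eq_div_card, sum_inv_card_smul_eq_div_card,
    le_div_iff₀' (Nat.cast_pos.2 Fintype.card_pos)] at h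

theorem card_mul_dilationDefect_lt (hH : StrictDilationConvex H b) (hu : ∀ i, 0 ≤ u i)
    (hsum : ∑ i, u i = Fintype.card I) (hy : ∀ j, 0 ≤ y j) (huy : ∀ i j, u i * y j < b)
    (hune : ∃ i i', u i ≠ u i') (hyne : ∃ j j', y j ≠ y j') :
    Fintype.card J * dilationDefect H u ((∑ j, y j) / Fintype.card J) <
      ∑ j, dilationDefect H u (y j) := by
  obtain ⟨j, j', hjj'⟩ := hyne
  have : Nonempty J := ⟨j⟩
  have hcard : (0 : ℝ) < Fintype.card J := Nat.cast_pos.2 Fintype.card_pos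
  obtain ⟨j₀, hj₀⟩ := Finite.exists_max y
  have h := (hH.strictConvexOn_dilationDefect (hy j₀) hu hsum (fun i => huy i j₀) hune).map_sum_lt
    (t := Finset.univ) (w := fun _ : J => (Fintype.card J : ℝ)⁻¹) (p := y)
    (fun _ _ => inv_pos.2 hcard) sum_inv_card_eq_one (fun j _ => ⟨hy j, hj₀ j⟩)
    ⟨j, Finset.mem_univ j, j', Finset.mem_univ j', hjj'⟩
  rwa [sum_inv_card_smul_eq_div_card, sum_inv_card_smul_eq_div_card, lt_div_iff₀' hcard] at h

end StrictDilationConvex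

section IndepRate

variable {I J : Type*} [Fintype I] [Fintype J] {H : ℝ → ℝ} {b : ℝ} {R : I → ℝ} {C : J → ℝ}

/-- The growth rate of the independence heuristic for the margins `R` and `C` when `H` is the
entropy per entry: a line of `n` entries with sum `r` contributes `n * H (r / n)`. -/
noncomputable def indepRate (H : ℝ → ℝ) (R : I → ℝ) (C : J → ℝ) : ℝ :=
  ∑ i, Fintype.card J * H (R i / Fintype.card J) + ∑ j, Fintype.card I * H (C j / Fintype.card I) -
    Fintype.card I * Fintype.card J * H ((∑ i, R i) / (Fintype.card I * Fintype.card J))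

theorem card_mul_div_mul_div_card [Nonempty I] (r c N : ℝ) :
    Fintype.card I * r / N * (c / Fintype.card I) = r * c / N := by
  have hI : (Fintype.card I : ℝ) ≠ 0 := Nat.cast_ne_zero.2 Fintype.card_ne_zero
  field_simp

theorem sum_card_mul_div_sum (hR : ∑ i, R i ≠ 0) :
    ∑ i, Fintype.card I * R i / ∑ i, R i = Fintype.card I := by
  rw [← Finset.sum_div, ← Finset.mul_sum, mul_div_cancel_right₀ _ hR]

/-- The row sums, normalised to mean `1`, are the weights by which a column of constant entry
`C j / |I|` has to be dilated to give the entries of the independence table. -/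
theorem sum_sub_indepRate_eq [Nonempty I] (H : ℝ → ℝ) (hR : ∑ i, R i ≠ 0)
    (hRC : ∑ j, C j = ∑ i, R i) :
    ∑ i, ∑ j, H (R i * C j / ∑ i, R i) - indepRate H R C =
      ∑ j, dilationDefect H (fun i => Fintype.card I * R i / ∑ i, R i) (C j / Fintype.card I) -
        Fintype.card J * dilationDefect H (fun i => Fintype.card I * R i / ∑ i, R i)
          ((∑ j, C j / Fintype.card I) / Fintype.card J) := by
  have hI : (Fintype.card I : ℝ) ≠ 0 := Nat.cast_ne_zero.2 Fintype.card_ne_zero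
  have hmean : (∑ j, C j / Fintype.card I) / Fintype.card J =
      (∑ i, R i) / (Fintype.card I * Fintype.card J) := by
    rw [← Finset.sum_div, hRC, div_div]
  have hrow : ∀ i, Fintype.card I * R i / (∑ i, R i) *
      ((∑ i, R i) / (Fintype.card I * Fintype.card J)) = R i / Fintype.card J :=
    fun i => by field_simp
  simp only [dilationDefect, indepRate, hmean, card_mul_div_mul_div_card, hrow,
    Finset.sum_sub_distrib, ← Finset.mul_sum]
  rw [Finset.sum_comm]
  ring

theorem indepRate_le [Nonempty I] [Nonempty J] (hH : StrictDilationConvex H b)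
    (hR : ∀ i, 0 ≤ R i) (hC : ∀ j, 0 ≤ C j) (hRC : ∑ j, C j = ∑ i, R i) (hpos : 0 < ∑ i, R i)
    (hb : ∀ i j, R i * C j / ∑ i, R i < b) :
    indepRate H R C ≤ ∑ i, ∑ j, H (R i * C j / ∑ i, R i) := by
  rw [← sub_nonneg, sum_sub_indepRate_eq H hpos.ne' hRC, sub_nonneg]
  refine hH.card_mul_dilationDefect_le (fun i => ?_) (sum_card_mul_div_sum hpos.ne')
    (fun j => div_nonneg (hC j) (Nat.cast_nonneg _)) fun i j => ?_
  · exact div_nonneg (mul_nonneg (Nat.cast_nonneg _) (hR i)) hpos.le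
  · rw [card_mul_div_mul_div_card]
    exact hb i j

theorem indepRate_lt (hH : StrictDilationConvex H b) (hR : ∀ i, 0 ≤ R i)
    (hC : ∀ j, 0 ≤ C j) (hRC : ∑ j, C j = ∑ i, R i) (hpos : 0 < ∑ i, R i)
    (hb : ∀ i j, R i * C j / ∑ i, R i < b) (hRne : ∃ i i', R i ≠ R i')
    (hCne : ∃ j j', C j ≠ C j') : indepRate H R C < ∑ i, ∑ j, H (R i * C j / ∑ i, R i) := by
  obtain ⟨i, i', hii'⟩ := hRne
  obtain ⟨j, j', hjj'⟩ := hCne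
  have : Nonempty I := ⟨i⟩
  have hI : (Fintype.card I : ℝ) ≠ 0 := Nat.cast_ne_zero.2 Fintype.card_ne_zero
  rw [← sub_pos, sum_sub_indepRate_eq H hpos.ne' hRC, sub_pos]
  refine hH.card_mul_dilationDefect_lt (fun i => ?_) (sum_card_mul_div_sum hpos.ne')
    (fun j => div_nonneg (hC j) (Nat.cast_nonneg _)) (fun i j => ?_) ⟨i, i', fun h => hii' ?_⟩
    ⟨j, j', fun h => hjj' ((div_left_inj' hI).1 h)⟩
  · exact div_nonneg (mul_nonneg (Nat.cast_nonneg _) (hR i)) hpos.le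
  · rw [card_mul_div_mul_div_card]
    exact hb i j
  · exact mul_left_cancel₀ hI ((div_left_inj' hpos.ne').1 h)

end IndepRate

section Clone

variable {m s : ℕ}

theorem clone_finProdFinEquiv (V : Fin m → ℕ) (p : Fin s × Fin m) :
    clone s V (finProdFinEquiv p) = s * V p.2 := by
  have hmod : (finProdFinEquiv.symm (finProdFinEquiv p)).2 = p.2 := by rw [Equiv.symm_apply_apply]
  exact congrArg (fun i => s * V i) hmod

theorem prod_clone {M : Type*} [CommMonoid M] (V : Fin m → ℕ) (f : ℕ → M) :
    ∏ k, f (clone s V k) = (∏ i, f (s * V i)) ^ s := by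
  rw [← finProdFinEquiv.prod_comp, Fintype.prod_prod_type]
  simp only [clone_finProdFinEquiv, Finset.prod_const, Finset.card_univ, Fintype.card_fin]

theorem sum_clone (V : Fin m → ℕ) : ∑ k, clone s V k = s ^ 2 * ∑ i, V i := by
  rw [← finProdFinEquiv.sum_comp, Fintype.sum_prod_type]
  simp only [clone_finProdFinEquiv, ← Finset.mul_sum, Finset.sum_const, Finset.card_univ,
    Fintype.card_fin, smul_eq_mul]
  ring

theorem tableCount_clone (κ : ℕ∞) {n : ℕ} (R : Fin m → ℕ) (C : Fin n → ℕ) :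
    tableCount κ (clone s R) (clone s C) = tiledCount κ R C s s := by
  rw [tableCount_eq_marginCount, ← marginCount_comp_equiv κ _ _ finProdFinEquiv finProdFinEquiv]
  simp only [Function.comp_def, clone_finProdFinEquiv]
  rfl

theorem log_indepEstimate_clone {κ : ℕ∞} {n : ℕ} {R : Fin m → ℕ} {C : Fin n → ℕ}
    (hR : ∀ i, 0 < knomial κ (s * n) (s * R i)) (hC : ∀ j, 0 < knomial κ (s * m) (s * C j))
    (hN : 0 < knomial κ (s ^ 2 * (m * n)) (s ^ 2 * ∑ i, R i)) :
    Real.log (indepEstimate κ (clone s R) (clone s C)) =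
      s * (∑ i, Real.log (knomial κ (s * n) (s * R i)) +
        ∑ j, Real.log (knomial κ (s * m) (s * C j))) -
        Real.log (knomial κ (s ^ 2 * (m * n)) (s ^ 2 * ∑ i, R i)) := by
  have hR' : ∀ i, (knomial κ (s * n) (s * R i) : ℝ) ≠ 0 := fun i => Nat.cast_ne_zero.2 (hR i).ne'
  have hC' : ∀ j, (knomial κ (s * m) (s * C j) : ℝ) ≠ 0 := fun j => Nat.cast_ne_zero.2 (hC j).ne'
  have hN' : (knomial κ (s ^ 2 * (m * n)) (s ^ 2 * ∑ i, R i) : ℝ)⁻¹ ≠ 0 :=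
    inv_ne_zero (Nat.cast_ne_zero.2 hN.ne')
  have hRprod := pow_ne_zero s (Finset.prod_ne_zero_iff.2 fun i (_ : i ∈ Finset.univ) => hR' i)
  have hCprod := pow_ne_zero s (Finset.prod_ne_zero_iff.2 fun j (_ : j ∈ Finset.univ) => hC' j)
  have hsize : s * m * (s * n) = s ^ 2 * (m * n) := by ring
  rw [indepEstimate, sum_clone, hsize, prod_clone R fun r => (knomial κ (s * n) r : ℝ),
    prod_clone C fun r => (knomial κ (s * m) r : ℝ), Real.log_mul (mul_ne_zero hN' hRprod) hCprod,
    Real.log_mul hN' hRprod, Real.log_inv, Real.log_pow, Real.log_pow,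
    Real.log_prod fun i _ => hR' i, Real.log_prod fun j _ => hC' j]
  ring

end Clone

/-- `H x` is the exponential growth rate per entry of the number of vectors with entries at most
`κ` and with mean `x < b`. -/
structure IsGrowthRate (κ : ℕ∞) (H : ℝ → ℝ) (b : ℝ) : Prop where
  knomial_pos : ∀ n r : ℕ, (r : ℝ) ≤ b * n → 0 < knomial κ n r
  tendsto_log_knomial : ∀ n r : ℕ, (r : ℝ) < b * n →
    Tendsto (fun s : ℕ => Real.log (knomial κ (s * n) (s * r)) / s) atTop (𝓝 (n * H (r / n)))

namespace IsGrowthRate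

variable {κ : ℕ∞} {H : ℝ → ℝ} {b : ℝ} {m n : ℕ} {R : Fin m → ℕ} {C : Fin n → ℕ}

theorem knomial_dilate_pos (hH : IsGrowthRate κ H b) {r : ℕ} (hr : (r : ℝ) < b * n) (s : ℕ) :
    0 < knomial κ (s * n) (s * r) := by
  refine hH.knomial_pos _ _ ?_
  push_cast
  rw [mul_left_comm]
  gcongr

theorem tendsto_log_indepEstimate (hH : IsGrowthRate κ H b) (hR : ∀ i, (R i : ℝ) < b * n)
    (hC : ∀ j, (C j : ℝ) < b * m) (hN : ((∑ i, R i : ℕ) : ℝ) < b * (m * n : ℕ)) :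
    Tendsto (fun s : ℕ => Real.log (indepEstimate κ (clone s R) (clone s C)) / (s : ℝ) ^ 2) atTop
      (𝓝 (indepRate H (fun i => (R i : ℝ)) fun j => (C j : ℝ))) := by
  have hrow := tendsto_finsetSum Finset.univ fun i _ => hH.tendsto_log_knomial n (R i) (hR i)
  have hcol := tendsto_finsetSum Finset.univ fun j _ => hH.tendsto_log_knomial m (C j) (hC j)
  have htotal := (hH.tendsto_log_knomial _ _ hN).comp (tendsto_pow_atTop two_ne_zero)
  simp only [indepRate, Fintype.card_fin]
  push_cast at htotal
  refine ((hrow.add hcol).sub htotal).congr' ?_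
  filter_upwards [eventually_ne_atTop 0] with s hs
  have hs' : (s : ℝ) ≠ 0 := Nat.cast_ne_zero.2 hs
  rw [log_indepEstimate_clone (fun i => hH.knomial_dilate_pos (hR i) s)
    (fun j => hH.knomial_dilate_pos (hC j) s) (hH.knomial_dilate_pos hN _), sub_div, pow_two,
    mul_div_mul_left _ _ hs', add_div, Finset.sum_div, Finset.sum_div]
  simp only [Function.comp, Nat.cast_mul, pow_two]

theorem sum_le_of_tendsto_log_tiledCount (hH : IsGrowthRate κ H b) (hpos : 0 < ∑ i, R i)
    (hRC : ∑ j, C j = ∑ i, R i) (hb : ∀ i j, (R i * C j : ℝ) < b * ∑ i, (R i : ℝ)) {L : ℝ}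
    (hL : ∀ k : ℕ, Real.log (tiledCount κ R C k k) / (k : ℝ) ^ 2 ≤ L) :
    ∑ i, ∑ j, H (R i * C j / ∑ i, (R i : ℝ)) ≤ L := by
  have hb' : ∀ i j, ((R i * C j : ℕ) : ℝ) < b * (∑ i, R i : ℕ) := by exact_mod_cast hb
  refine sum_rate_le_of_tendsto_log_knomial hpos.ne' rfl hRC hL
    (fun s i j => hH.knomial_dilate_pos (hb' i j) s) fun i j => ?_
  exact_mod_cast hH.tendsto_log_knomial _ _ (hb' i j)

end IsGrowthRate

theorem natCast_lt_mul_card {I J : Type*} [Fintype J] {R : I → ℕ} {C : J → ℕ} {b : ℝ}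
    (hpos : 0 < ∑ j, C j) (hb : ∀ i j, (R i * C j : ℝ) < b * ∑ j, (C j : ℝ)) (i : I) :
    (R i : ℝ) < b * Fintype.card J := by
  have hJ := Finset.nonempty_of_sum_ne_zero hpos.ne'
  have hpos' : 0 < ∑ j, (C j : ℝ) := by exact_mod_cast hpos
  have hsum := Finset.sum_lt_sum_of_nonempty hJ fun j _ => hb i j
  rw [← Finset.mul_sum, Finset.sum_const, Finset.card_univ, nsmul_eq_mul, ← mul_assoc] at hsum
  linarith [lt_of_mul_lt_mul_right hsum hpos'.le]

theorem exists_tendsto_log_tableCount_log_indepEstimate {κ : ℕ∞} {H : ℝ → ℝ} {b : ℝ}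
    {m n : ℕ} {R : Fin m → ℕ} {C : Fin n → ℕ}
    (hH : IsGrowthRate κ H b) (hconv : StrictDilationConvex H b) (hpos : 0 < ∑ i, R i)
    (hRC : ∑ j, C j = ∑ i, R i) (hT : 0 < tableCount κ R C)
    (hb : ∀ i j, (R i * C j : ℝ) < b * ∑ i, (R i : ℝ)) :
    ∃ LT LI : ℝ,
      Tendsto (fun s : ℕ => Real.log (tableCount κ (clone s R) (clone s C)) / (s : ℝ) ^ 2) atTop
        (𝓝 LT) ∧
      Tendsto (fun s : ℕ => Real.log (indepEstimate κ (clone s R) (clone s C)) / (s : ℝ) ^ 2) atTop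
        (𝓝 LI) ∧
      LI ≤ LT ∧ ((∃ i i', R i ≠ R i') → (∃ j j', C j ≠ C j') → LI < LT) := by
  have hpos' : 0 < ∑ i, (R i : ℝ) := by exact_mod_cast hpos
  have hRC' : ∑ j, (C j : ℝ) = ∑ i, (R i : ℝ) := by exact_mod_cast hRC
  have hrow := natCast_lt_mul_card (C := C) (by rwa [hRC]) (by rwa [hRC'])
  have hcol := natCast_lt_mul_card (R := C) (C := R) hpos fun j i => by
    rw [mul_comm]
    exact hb i j
  have hI := Finset.nonempty_of_sum_ne_zero hpos.ne'
  have hJ := Finset.nonempty_of_sum_ne_zero (hRC ▸ hpos.ne')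
  have : Nonempty (Fin m) := Finset.univ_nonempty_iff.1 hI
  have : Nonempty (Fin n) := Finset.univ_nonempty_iff.1 hJ
  rw [Fintype.card_fin] at hrow hcol
  have htotal : ((∑ i, R i : ℕ) : ℝ) < b * (m * n : ℕ) := by
    have hsum := Finset.sum_lt_sum_of_nonempty hI fun i _ => hrow i
    rw [Finset.sum_const, Finset.card_univ, Fintype.card_fin, nsmul_eq_mul] at hsum
    push_cast
    linarith
  have hb' : ∀ i j, (R i * C j : ℝ) / ∑ i, (R i : ℝ) < b := fun i j =>
    (div_lt_iff₀ hpos').2 (hb i j)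
  obtain ⟨LT, hLT, hle⟩ := exists_tendsto_log_tiledCount (κ := κ) (R := R) (C := C) hT
  have hLT' := hH.sum_le_of_tendsto_log_tiledCount hpos hRC hb hle
  simp only [← tableCount_clone] at hLT
  refine ⟨LT, _, hLT, hH.tendsto_log_indepEstimate hrow hcol htotal, ?_, fun hR hC => ?_⟩
  · exact (indepRate_le hconv (fun _ => Nat.cast_nonneg _) (fun _ => Nat.cast_nonneg _) hRC' hpos'
      hb').trans hLT'
  · exact (indepRate_lt hconv (fun _ => Nat.cast_nonneg _) (fun _ => Nat.cast_nonneg _) hRC' hpos'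
      hb' (by exact_mod_cast hR) (by exact_mod_cast hC)).trans_le hLT'

/-- A branch `Z`, vanishing at `0`, of solutions `z = Z x` of the saddle point equation
`z * F' z / F z = x` of a generating function `F`. The last field is the convexity property of the
associated entropy, whose second derivative is `-logDeriv Z`. -/
structure IsSaddleBranch (F Z : ℝ → ℝ) (b : ℝ) : Prop where
  map_zero : Z 0 = 0
  continuousAt_zero : ContinuousAt Z 0
  mem_Ioo : ∀ x ∈ Set.Ioo 0 b, Z x ∈ Set.Ioo 0 1
  mul_logDeriv : ∀ x ∈ Set.Ioo 0 b, Z x * logDeriv F (Z x) = x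
  differentiableAt : ∀ x ∈ Set.Ioo 0 b, DifferentiableAt ℝ Z x
  strictConcaveOn : StrictConcaveOn ℝ (Set.Ico 0 b) fun x => x ^ 2 * logDeriv Z x

/-- The entropy with mean `x` read off at the saddle point `Z x`. -/
noncomputable def saddleEntropy (F Z : ℝ → ℝ) (x : ℝ) : ℝ :=
  Real.log (F (Z x)) - x * Real.log (Z x)

namespace IsSaddleBranch

variable {F Z : ℝ → ℝ} {b : ℝ}

theorem hasDerivAt_saddleEntropy (hZ : IsSaddleBranch F Z b) {x : ℝ} (hx : x ∈ Set.Ioo 0 b) :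
    HasDerivAt (saddleEntropy F Z) (-Real.log (Z x)) x := by
  have hlog : logDeriv F (Z x) ≠ 0 := fun h =>
    hx.1.ne' (by rw [← hZ.mul_logDeriv x hx, h, mul_zero])
  obtain ⟨hderiv, hFZ⟩ := div_ne_zero_iff.1 hlog
  have hZx := (hZ.mem_Ioo x hx).1.ne'
  have hZ' := (hZ.differentiableAt x hx).hasDerivAt
  have hF' := (differentiableAt_of_deriv_ne_zero hderiv).hasDerivAt
  refine ((HasDerivAt.log (hF'.comp x hZ') hFZ).fun_sub
    ((hasDerivAt_id' x).fun_mul (hZ'.log hZx))).congr_deriv ?_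
  have hsaddle : deriv F (Z x) / F (Z x) = x / Z x := by
    rw [eq_div_iff hZx, mul_comm]
    exact hZ.mul_logDeriv x hx
  rw [Function.comp_apply, mul_div_right_comm, hsaddle]
  ring

theorem hasDerivAt_deriv_saddleEntropy (hZ : IsSaddleBranch F Z b) {x : ℝ}
    (hx : x ∈ Set.Ioo 0 b) : HasDerivAt (deriv (saddleEntropy F Z)) (-logDeriv Z x) x := by
  refine ((hZ.differentiableAt x hx).hasDerivAt.log
    (hZ.mem_Ioo x hx).1.ne').fun_neg.congr_of_eventuallyEq ?_
  filter_upwards [Ioo_mem_nhds hx.1 hx.2] with t ht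
  exact (hZ.hasDerivAt_saddleEntropy ht).deriv

theorem continuousWithinAt_saddleEntropy_zero (hZ : IsSaddleBranch F Z b) (hF : AnalyticAt ℝ F 0)
    (hF0 : F 0 ≠ 0) : ContinuousWithinAt (saddleEntropy F Z) (Set.Ico 0 b) 0 := by
  have hFZ : ContinuousAt (fun x => F (Z x)) 0 :=
    ContinuousAt.comp (by rw [hZ.map_zero]; exact hF.continuousAt) hZ.continuousAt_zero
  have hF'Z : ContinuousAt (fun x => deriv F (Z x)) 0 :=
    ContinuousAt.comp (g := deriv F) (by rw [hZ.map_zero]; exact hF.deriv.continuousAt)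
      hZ.continuousAt_zero
  have hF0' : F (Z 0) ≠ 0 := by rwa [hZ.map_zero]
  have hcont : ContinuousAt (fun x => Real.log (F (Z x)) +
      deriv F (Z x) / F (Z x) * Real.negMulLog (Z x)) 0 :=
    (hFZ.log hF0').add ((hF'Z.div hFZ hF0').mul
      (Real.continuous_negMulLog.continuousAt.comp hZ.continuousAt_zero))
  have heq_zero : saddleEntropy F Z 0 = Real.log (F (Z 0)) +
      deriv F (Z 0) / F (Z 0) * Real.negMulLog (Z 0) := by
    simp [saddleEntropy, hZ.map_zero]
  refine hcont.continuousWithinAt.congr (fun x hx => ?_) heq_zero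
  rcases hx.1.eq_or_lt with rfl | hx0
  · exact heq_zero
  · rw [saddleEntropy, Real.negMulLog]
    nth_rw 2 [← hZ.mul_logDeriv x ⟨hx0, hx.2⟩]
    rw [logDeriv_apply]
    ring

theorem strictDilationConvex (hZ : IsSaddleBranch F Z b) (hF : AnalyticAt ℝ F 0)
    (hF0 : F 0 ≠ 0) : StrictDilationConvex (saddleEntropy F Z) b where
  continuousOn x hx := by
    rcases hx.1.eq_or_lt with rfl | hx0
    · exact hZ.continuousWithinAt_saddleEntropy_zero hF hF0
    · exact (hZ.hasDerivAt_saddleEntropy ⟨hx0, hx.2⟩).continuousAt.continuousWithinAt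
  differentiableAt x hx := (hZ.hasDerivAt_saddleEntropy hx).differentiableAt
  differentiableAt_deriv x hx := (hZ.hasDerivAt_deriv_saddleEntropy hx).differentiableAt
  strictConvexOn := by
    refine hZ.strictConcaveOn.neg.congr fun x hx => ?_
    rcases hx.1.eq_or_lt with rfl | hx0
    · simp
    · simp [(hZ.hasDerivAt_deriv_saddleEntropy ⟨hx0, hx.2⟩).deriv]

end IsSaddleBranch

theorem knomialGF_zero (κ : ℕ∞) : knomialGF κ 0 = 1 :=
  le_antisymm (by simpa using knomialGF_le κ le_rfl one_pos) (one_le_knomialGF κ le_rfl one_pos)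

theorem knomial_zero_right (κ : ℕ∞) (n : ℕ) : knomial κ n 0 = 1 := by
  refine le_antisymm ?_ (knomial_pos (K := 0) bot_le (Nat.zero_le _))
  have h := knomial_mul_pow_le κ le_rfl one_pos n 0
  rw [knomialGF_zero, one_pow, pow_zero, mul_one] at h
  exact_mod_cast h

theorem IsSaddleBranch.isGrowthRate {κ : ℕ∞} {Z : ℝ → ℝ} {b : ℝ} {K : ℕ}
    (hZ : IsSaddleBranch (knomialGF κ) Z b) (hK : (K : ℕ∞) ≤ κ) (hb : b ≤ K) :
    IsGrowthRate κ (saddleEntropy (knomialGF κ) Z) b where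
  knomial_pos n r hr := by
    refine knomial_pos hK ?_
    have h : (r : ℝ) ≤ K * n := hr.trans (by gcongr)
    exact_mod_cast h
  tendsto_log_knomial n r hr := by
    rcases r.eq_zero_or_pos with rfl | hr0
    · simp [knomial_zero_right, saddleEntropy, hZ.map_zero, knomialGF_zero]
    have hrK : (r : ℝ) < K * n := hr.trans_le (by gcongr)
    have hn : (0 : ℝ) < n := Nat.cast_pos.2 <| Nat.pos_of_ne_zero fun h => by
      rw [h, Nat.cast_zero, mul_zero] at hrK
      exact hrK.not_ge r.cast_nonneg
    have hx : (r : ℝ) / n ∈ Set.Ioo 0 b := ⟨by positivity, (div_lt_iff₀ hn).2 hr⟩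
    obtain ⟨hz0, hz1⟩ := hZ.mem_Ioo _ hx
    have h := tendsto_log_knomial (n := n) hK hr0 (by exact_mod_cast hrK) hz0 hz1
      (by rw [hZ.mul_logDeriv _ hx, mul_div_cancel₀ _ hn.ne'])
    rwa [saddleEntropy, mul_sub, ← mul_assoc, mul_div_cancel₀ _ hn.ne']

theorem logDeriv_knomialGF_top {z : ℝ} (hz : |z| < 1) :
    logDeriv (knomialGF ⊤) z = (1 - z)⁻¹ := by
  have hne : 1 - z ≠ 0 := sub_ne_zero.2 (abs_lt.1 hz).2.ne'
  have heq : knomialGF ⊤ =ᶠ[𝓝 z] fun w => (1 - w)⁻¹ :=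
    (continuous_abs.continuousAt.eventually_lt_const hz).mono fun w hw => knomialGF_top hw
  have hderiv : HasDerivAt (fun w : ℝ => (1 - w)⁻¹) (1 / (1 - z) ^ 2) z :=
    (((hasDerivAt_id' z).const_sub 1).fun_inv hne).congr_deriv (by rw [neg_neg])
  rw [(logDeriv_congr_nhds heq).self_of_nhds, logDeriv_apply, hderiv.deriv]
  field_simp

theorem analyticAt_knomialGF_top : AnalyticAt ℝ (knomialGF ⊤) 0 := by
  have heq : (fun w => (1 - w)⁻¹) =ᶠ[𝓝 (0 : ℝ)] knomialGF ⊤ :=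
    (continuous_abs.continuousAt.eventually_lt_const (by simp)).mono fun w hw =>
      (knomialGF_top hw).symm
  exact ((analyticAt_const.sub analyticAt_id).inv (by simp)).congr heq

theorem logDeriv_div_one_add {x : ℝ} (hx : 0 < x) :
    logDeriv (fun t : ℝ => t / (1 + t)) x = (x * (1 + x))⁻¹ := by
  have hx1 : 1 + x ≠ 0 := by positivity
  have h := (hasDerivAt_id' x).fun_div ((hasDerivAt_id' x).const_add 1) hx1
  rw [logDeriv_apply, h.deriv]
  field_simp
  ring

theorem strictConcaveOn_div_one_add :
    StrictConcaveOn ℝ (Set.Ici 0) fun x : ℝ => x / (1 + x) := by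
  have h : StrictConvexOn ℝ (Set.Ici 0) fun x : ℝ => (1 + x)⁻¹ := by
    refine (((strictConvexOn_zpow (m := -1) (by decide) (by decide)).translate_right 1).subset
      (fun x hx => ?_) (convex_Ici 0)).congr fun x _ => zpow_neg_one _
    exact add_pos_of_pos_of_nonneg zero_lt_one (Set.mem_Ici.1 hx)
  refine (h.neg.add_const 1).congr fun x hx => ?_
  have hx1 : 1 + x ≠ 0 := by have := Set.mem_Ici.1 hx; positivity
  rw [Pi.add_apply, Pi.neg_apply]
  field_simp
  ring

theorem isSaddleBranch_knomialGF_top (b : ℝ) :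
    IsSaddleBranch (knomialGF ⊤) (fun x => x / (1 + x)) b where
  map_zero := zero_div _
  continuousAt_zero := continuousAt_id.div (continuousAt_const.add continuousAt_id) (by simp)
  mem_Ioo x hx := by
    have hx0 := hx.1
    exact ⟨by positivity, (div_lt_one (by positivity)).2 (by linarith)⟩
  mul_logDeriv x hx := by
    have hx0 := hx.1
    have h1 : x / (1 + x) < 1 := (div_lt_one (by positivity)).2 (by linarith)
    rw [logDeriv_knomialGF_top (abs_lt.2 ⟨neg_one_lt_zero.trans (by positivity), h1⟩)]
    have h : 1 - x / (1 + x) = (1 + x)⁻¹ := by field_simp; ring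
    rw [h]
    field_simp
  differentiableAt x hx := by
    have := hx.1
    exact differentiableAt_id.div (differentiableAt_id.const_add 1) (by positivity)
  strictConcaveOn := by
    refine (strictConcaveOn_div_one_add.subset Set.Ico_subset_Ici_self (convex_Ico 0 b)).congr
      fun x hx => ?_
    rcases hx.1.eq_or_lt with rfl | hx0
    · simp
    · rw [logDeriv_div_one_add hx0]
      field_simp

theorem exists_analyticAt_rightInverse_mul {G : ℝ → ℝ} (hG : AnalyticAt ℝ G 0) (hG0 : G 0 ≠ 0) :
    ∃ Z : ℝ → ℝ, AnalyticAt ℝ Z 0 ∧ Z 0 = 0 ∧ deriv Z 0 = (G 0)⁻¹ ∧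
      ∀ᶠ x in 𝓝 0, Z x * G (Z x) = x := by
  have hA : AnalyticAt ℝ (fun z => z * G z) 0 := analyticAt_id.mul hG
  have hd : deriv (fun z => z * G z) 0 = G 0 := by
    rw [((hasDerivAt_id' 0).fun_mul hG.differentiableAt.hasDerivAt).deriv]
    ring
  have hne : deriv (fun z => z * G z) 0 ≠ 0 := by rwa [hd]
  have hanalytic := hA.analyticAt_localInverse hne
  have hderiv := hA.hasStrictDerivAt.to_localInverse hne
  have hinv := hA.hasStrictDerivAt.eventually_right_inverse hne
  have hzero : hA.hasStrictDerivAt.localInverse _ _ _ hne (0 * G 0) = 0 :=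
    HasStrictFDerivAt.localInverse_apply_image ..
  simp only [zero_mul] at hanalytic hderiv hinv hzero
  exact ⟨_, hanalytic, hzero, by rw [hderiv.hasDerivAt.deriv, hd], hinv⟩

theorem sq_mul_logDeriv_of_eventually_mul_eq {Z g : ℝ → ℝ} {x : ℝ} (hZ : DifferentiableAt ℝ Z x)
    (hg : DifferentiableAt ℝ g x) (h : ∀ᶠ y in 𝓝 x, Z y * g y = y) :
    x ^ 2 * logDeriv Z x = x - x ^ 2 * logDeriv g x := by
  rcases eq_or_ne x 0 with rfl | hx
  · simp
  obtain ⟨hZx, hgx⟩ := mul_ne_zero_iff.1 (h.self_of_nhds.trans_ne hx)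
  have hlog : logDeriv Z x + logDeriv g x = x⁻¹ := by
    rw [← logDeriv_mul x hZx hgx hZ hg, (logDeriv_congr_nhds h).self_of_nhds, logDeriv_apply,
      deriv_id'', one_div]
  rw [eq_sub_of_add_eq hlog]
  field_simp

theorem exists_isSaddleBranch {F : ℝ → ℝ} (hF : AnalyticAt ℝ F 0) (hG0 : 0 < logDeriv F 0)
    (hG0' : 0 < deriv (logDeriv F) 0) :
    ∃ Z : ℝ → ℝ, ∃ ε > 0, ∀ b ≤ ε, IsSaddleBranch F Z b := by
  set G := logDeriv F
  have hG : AnalyticAt ℝ G 0 := hF.deriv.div hF (div_ne_zero_iff.1 hG0.ne').2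
  obtain ⟨Z, hZ, hZ0, hZ0', hsaddle⟩ := exists_analyticAt_rightInverse_mul hG hG0.ne'
  have hGZ : AnalyticAt ℝ (fun x => G (Z x)) 0 := AnalyticAt.comp (g := G) (by rwa [hZ0]) hZ
  have hGZ0 : G (Z 0) = G 0 := by rw [hZ0]
  set f : ℝ → ℝ := logDeriv fun x => G (Z x)
  have hf : AnalyticAt ℝ f 0 := hGZ.deriv.div hGZ (by rw [hGZ0]; exact hG0.ne')
  have hf0 : 0 < f 0 := by
    have h : f 0 = logDeriv G (Z 0) * deriv Z 0 :=
      logDeriv_comp (by rw [hZ0]; exact hG.differentiableAt) hZ.differentiableAt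
    rw [h, hZ0, hZ0', logDeriv_apply]
    positivity
  obtain ⟨ε₁, hε₁, hconvex⟩ := exists_strictConvexOn_sq_mul hf hf0
  have hnear : ∀ᶠ x in 𝓝 0, Z x < 1 ∧ 0 < G (Z x) ∧ DifferentiableAt ℝ Z x ∧
      DifferentiableAt ℝ (fun x => G (Z x)) x ∧ ∀ᶠ y in 𝓝 x, Z y * G (Z y) = y :=
    (hZ.continuousAt.eventually_lt_const (by simp [hZ0])).and <|
      (hGZ.continuousAt.eventually_const_lt (by simpa only [hGZ0])).and <|
      (hZ.eventually_analyticAt.mono fun _ h => h.differentiableAt).and <|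
      (hGZ.eventually_analyticAt.mono fun _ h => h.differentiableAt).and hsaddle.eventually_nhds
  obtain ⟨ε₂, hε₂, hball⟩ := Metric.eventually_nhds_iff.1 hnear
  have hgood {b x : ℝ} (hb : b ≤ min ε₁ ε₂) (hx : x ∈ Set.Ico 0 b) := hball (y := x) <| by
    rw [Real.dist_0_eq_abs, abs_of_nonneg hx.1]
    exact hx.2.trans_le (hb.trans (min_le_right _ _))
  refine ⟨Z, min ε₁ ε₂, lt_min hε₁ hε₂, fun b hb => ⟨hZ0, hZ.continuousAt, fun x hx => ?_,
    fun x hx => ?_, fun x hx => ?_, ?_⟩⟩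
  · obtain ⟨hlt, hGx, -, -, heq⟩ := hgood hb (Set.Ioo_subset_Ico_self hx)
    exact ⟨pos_of_mul_pos_left (hx.1.trans_eq heq.self_of_nhds.symm) hGx.le, hlt⟩
  · exact (hgood hb (Set.Ioo_subset_Ico_self hx)).2.2.2.2.self_of_nhds
  · exact (hgood hb (Set.Ioo_subset_Ico_self hx)).2.2.1
  · refine ((concaveOn_id (convex_Ico 0 b)).sub_strictConvexOn
      (hconvex b (hb.trans (min_le_left _ _)))).congr fun x hx => ?_
    obtain ⟨-, -, hZx, hGZx, heq⟩ := hgood hb hx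
    exact (sq_mul_logDeriv_of_eventually_mul_eq hZx hGZx heq).symm

/-- The polynomial `1 + X + ⋯ + X ^ K` whose values are those of `knomialGF K`. -/
noncomputable def knomialPolynomial (K : ℕ) : Polynomial ℝ :=
  ∑ t ∈ Finset.range (K + 1), Polynomial.X ^ t

theorem knomialGF_natCast_eq_eval (K : ℕ) :
    knomialGF K = fun z => (knomialPolynomial K).eval z := by
  ext z
  rw [knomialGF_natCast, knomialPolynomial, Polynomial.eval_finsetSum]
  simp only [Polynomial.eval_pow, Polynomial.eval_X]

theorem coeff_knomialPolynomial {K t : ℕ} (h : t ≤ K) : (knomialPolynomial K).coeff t = 1 := by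
  simp [knomialPolynomial, Polynomial.coeff_X_pow, Nat.lt_succ_of_le h]

theorem analyticAt_knomialGF_natCast (K : ℕ) (z : ℝ) : AnalyticAt ℝ (knomialGF K) z := by
  rw [knomialGF_natCast_eq_eval]
  exact AnalyticOnNhd.eval_polynomial _ z (Set.mem_univ z)

theorem logDeriv_eval_zero (p : Polynomial ℝ) :
    logDeriv (fun z => p.eval z) 0 = p.coeff 1 / p.coeff 0 := by
  rw [logDeriv_apply, Polynomial.deriv, ← Polynomial.coeff_zero_eq_eval_zero,
    ← Polynomial.coeff_zero_eq_eval_zero, Polynomial.coeff_derivative]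
  simp

theorem deriv_logDeriv_eval_zero {p : Polynomial ℝ} (h : p.coeff 0 ≠ 0) :
    deriv (logDeriv fun z => p.eval z) 0 =
      2 * p.coeff 2 / p.coeff 0 - (p.coeff 1 / p.coeff 0) ^ 2 := by
  have heq : (logDeriv fun z => p.eval z) = fun z => p.derivative.eval z / p.eval z := by
    ext z
    rw [logDeriv_apply, Polynomial.deriv]
  have hp : p.eval 0 ≠ 0 := by rwa [← Polynomial.coeff_zero_eq_eval_zero]
  rw [heq, ((p.derivative.hasDerivAt 0).fun_div (p.hasDerivAt 0) hp).deriv]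
  simp only [← Polynomial.coeff_zero_eq_eval_zero, Polynomial.coeff_derivative]
  field_simp
  push_cast
  ring

theorem exists_isSaddleBranch_knomialGF_natCast {K : ℕ} (hK : 2 ≤ K) :
    ∃ Z : ℝ → ℝ, ∃ ε > 0, ∀ b ≤ ε, IsSaddleBranch (knomialGF K) Z b := by
  have h0 := coeff_knomialPolynomial K.zero_le
  have h1 := coeff_knomialPolynomial (one_le_two.trans hK)
  have h2 := coeff_knomialPolynomial hK
  refine exists_isSaddleBranch (analyticAt_knomialGF_natCast K 0) ?_ ?_ <;>
    rw [knomialGF_natCast_eq_eval]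
  · rw [logDeriv_eval_zero, h0, h1]
    norm_num
  · rw [deriv_logDeriv_eval_zero (h0.trans_ne one_ne_zero), h0, h1, h2]
    norm_num

theorem exists_isGrowthRate_strictDilationConvex_top (b : ℝ) :
    ∃ H, IsGrowthRate ⊤ H b ∧ StrictDilationConvex H b := by
  obtain ⟨K, hK⟩ := exists_nat_ge b
  have hZ := isSaddleBranch_knomialGF_top b
  exact ⟨_, hZ.isGrowthRate le_top hK,
    hZ.strictDilationConvex analyticAt_knomialGF_top (by simp [knomialGF_zero])⟩

theorem exists_isGrowthRate_strictDilationConvex_natCast {K : ℕ} (hK : 2 ≤ K) :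
    ∃ b > 0, ∃ H, IsGrowthRate K H b ∧ StrictDilationConvex H b := by
  obtain ⟨Z, ε, hε, hZ⟩ := exists_isSaddleBranch_knomialGF_natCast hK
  have hZ := hZ (min ε K) (min_le_left _ _)
  exact ⟨min ε K, lt_min hε (by positivity), _, hZ.isGrowthRate le_rfl (min_le_right _ _),
    hZ.strictDilationConvex (analyticAt_knomialGF_natCast K 0) (by simp [knomialGF_zero])⟩

theorem exists_delta_isGrowthRate {κ : ℕ∞} (hκ : 2 ≤ κ) :
    ∃ δ : ℝ, 0 < δ ∧ δ < 1 ∧ ∀ B : ℝ, ENNReal.ofReal B < ENNReal.ofReal δ * κ →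
      ∃ b > B, ∃ H, IsGrowthRate κ H b ∧ StrictDilationConvex H b := by
  cases κ with
  | top =>
    exact ⟨1 / 2, one_half_pos, one_half_lt_one, fun B _ =>
      ⟨B + 1, lt_add_one B, exists_isGrowthRate_strictDilationConvex_top _⟩⟩
  | coe K =>
    have hK : 2 ≤ K := by exact_mod_cast hκ
    have hK0 : (0 : ℝ) < K := by positivity
    obtain ⟨b, hb, H, hH⟩ := exists_isGrowthRate_strictDilationConvex_natCast hK
    refine ⟨min (b / K) (1 / 2), by positivity, (min_le_right _ _).trans_lt one_half_lt_one,
      fun B hB => ⟨b, ?_, H, hH⟩⟩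
    rw [ENat.toENNReal_coe, ← ENNReal.ofReal_natCast, ← ENNReal.ofReal_mul (by positivity)] at hB
    calc B < min (b / K) (1 / 2) * K := ENNReal.ofReal_lt_ofReal_iff'.1 hB |>.1
      _ ≤ b := (le_div_iff₀ hK0).1 (min_le_left _ _)

theorem theorem4 (κ : ℕ∞) (hκ : 2 ≤ κ) :
    ∃ δ : ℝ, 0 < δ ∧ δ < 1 ∧
      ∀ (m n N : ℕ) (R : Fin m → ℕ) (C : Fin n → ℕ),
        ∑ i, R i = N → ∑ j, C j = N → 0 < tableCount κ R C →
        ((Finset.univ.sup R : ℕ) : ℝ≥0∞) * ((Finset.univ.sup C : ℕ) : ℝ≥0∞) <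
          ENNReal.ofReal δ * (κ : ℝ≥0∞) * (N : ℝ≥0∞) →
        ∃ LT LI : ℝ,
          Tendsto (fun s : ℕ => 1 / (s : ℝ) ^ 2 *
            Real.log (tableCount κ (clone s R) (clone s C))) atTop (𝓝 LT) ∧
          Tendsto (fun s : ℕ => 1 / (s : ℝ) ^ 2 *
            Real.log (indepEstimate κ (clone s R) (clone s C))) atTop (𝓝 LI) ∧
          LI ≤ LT ∧
          ((¬ ∀ i i', R i = R i') → (¬ ∀ j j', C j = C j') → LI < LT) := by
  obtain ⟨δ, hδ0, hδ1, hδ⟩ := exists_delta_isGrowthRate hκ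
  refine ⟨δ, hδ0, hδ1, fun m n N R C hR hC hT h => ?_⟩
  have hN : 0 < N := Nat.pos_of_ne_zero fun hN => by simp [hN] at h
  have hN' : (0 : ℝ) < N := Nat.cast_pos.2 hN
  set B : ℝ := (Finset.univ.sup R * Finset.univ.sup C : ℕ) / N
  have hB : ENNReal.ofReal B < ENNReal.ofReal δ * κ := by
    rw [ENNReal.ofReal_div_of_pos hN', ENNReal.ofReal_natCast, ENNReal.ofReal_natCast,
      Nat.cast_mul]
    exact ENNReal.div_lt_of_lt_mul h
  obtain ⟨b, hBb, H, hH, hconv⟩ := hδ B hB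
  have hRC (i : Fin m) (j : Fin n) : (R i * C j : ℝ) < b * ∑ i, (R i : ℝ) := by
    have hle : R i * C j ≤ Finset.univ.sup R * Finset.univ.sup C :=
      Nat.mul_le_mul (Finset.le_sup (Finset.mem_univ i)) (Finset.le_sup (Finset.mem_univ j))
    rw [← Nat.cast_sum, hR]
    exact lt_of_le_of_lt (by exact_mod_cast hle) ((div_lt_iff₀ hN').1 hBb)
  push Not
  simp only [one_div_mul_eq_div]
  exact exists_tendsto_log_tableCount_log_indepEstimate hH hconv (hR ▸ hN) (hC.trans hR.symm) hT hRC
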